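/- Let $M$ be a smooth surface (Hausdorff, second countable, without boundary) and let $\mathcal L$ be a smooth one-dimensional foliation of $M$, regarded as a smooth line field $\mathcal L\subset TM$. Let $\mathcal F$ be a closed leaf of $\mathcal L$ with non-degenerate linear monodromy, i.e. the linearized Poincaré return map of $\mathcal F$ on a transversal is $t\mapsto c\,t$ with $c>0$ and $c\neq 1$. Suppose that $\mathcal F$ has an open neighbourhood $U\subseteq M$ with a diffeomorphism $U\to S^1\times(-\varepsilon,\varepsilon)$, $\varepsilon>0$, that maps $\mathcal F$ onto $S^1\times\{0\}$. Then there are an open set $V$ with $\mathcal F\subset V\subseteq U$, a number $\delta>0$ and a diffeomorphism $\phi:V\to S^1\times(-\delta,\delta)$ such that 1. $\phi^{-1}(S^1\times\{0\})=\mathcal F$; 2. with coordinates $(\theta,r)\in S^1\times(-\delta,\delta)$, there is a real number $\lambda\neq0$ with $\phi^*\big(\ker(dr+\lambda\, r\, d\theta)\big)=\mathcal L$ on $V$, i.e. $\mathcal L_y=(d\phi_y)^{-1}\big(\ker(dr+\lambda\, r\,d\theta)_{\phi(y)}\big)$ for all $y\in V$. -/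

import Mathlib

open Set
open scoped Manifold ContDiff

noncomputable section

/-- A smooth one-dimensional foliation of a manifold `M`, given by its tangent line field: a line
`L.line x` in each tangent space, spanned near every point by a nowhere vanishing smooth vector
field. (A line field is automatically integrable; its leaves are the sets `L.leaf x` below.) -/
structure LineFoliation {E H : Type*} [NormedAddCommGroup E] [NormedSpace ℝ E]
    [TopologicalSpace H] (I : ModelWithCorners ℝ E H)
    (M : Type*) [TopologicalSpace M] [ChartedSpace H M] [IsManifold I ∞ M] where
  /-- the tangent line of the foliation at a point -/
  line : ∀ x : M, Submodule ℝ (TangentSpace I x)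
  locally_spanned : ∀ x : M, ∃ W : Set M, IsOpen W ∧ x ∈ W ∧
    ∃ X : ∀ y : M, TangentSpace I y,
      ContMDiffOn I I.tangent ∞ (fun y => (⟨y, X y⟩ : TangentBundle I M)) W ∧
      ∀ y ∈ W, X y ≠ 0 ∧ line y = Submodule.span ℝ {X y}

namespace LineFoliation

variable {E H : Type*} [NormedAddCommGroup E] [NormedSpace ℝ E]
  [TopologicalSpace H] {I : ModelWithCorners ℝ E H}
  {M : Type*} [TopologicalSpace M] [ChartedSpace H M] [IsManifold I ∞ M]

/-- A smooth path everywhere tangent to the foliation (its velocity may vanish, so that paths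
can be smoothly concatenated after reparametrization). -/
structure IsLeafPath (L : LineFoliation I M) (γ : ℝ → M) : Prop where
  smooth : ContMDiff 𝓘(ℝ, ℝ) I ∞ γ
  tangent : ∀ s : ℝ, mfderiv 𝓘(ℝ, ℝ) I γ s (1 : ℝ) ∈ L.line (γ s)

/-- The leaf through `x`: all points that can be joined to `x` by a path tangent to the
foliation. -/
def leaf (L : LineFoliation I M) (x : M) : Set M :=
  {y | ∃ γ : ℝ → M, L.IsLeafPath γ ∧ γ 0 = x ∧ γ 1 = y}

/-- A parametrized transversal: a smooth curve that is nowhere tangent to the foliation. -/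
structure IsTransversal (L : LineFoliation I M) (τ : ℝ → M) : Prop where
  smooth : ContMDiff 𝓘(ℝ, ℝ) I ∞ τ
  transverse : ∀ t : ℝ, mfderiv 𝓘(ℝ, ℝ) I τ t (1 : ℝ) ∉ L.line (τ t)

/-- `P` is (a representative of the germ at `0` of) the Poincaré return map of the closed leaf
`F` on the transversal `τ`, which crosses `F` at `τ 0`. There is a smooth family `h (·, t)` of
paths in the leaves, for small `t`, such that `h (·, 0)` runs through `F` exactly once, starting
and ending at `τ 0`, and `h (·, t)` leads from the point `τ t` of the transversal back to the
point `τ (P t)` of the transversal. -/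
def IsReturnMap (L : LineFoliation I M) (F : Set M) (τ : ℝ → M) (P : ℝ → ℝ) : Prop :=
  L.IsTransversal τ ∧ P 0 = 0 ∧
  ∃ a : ℝ, 0 < a ∧ ∃ h : ℝ × ℝ → M,
    ContMDiffOn 𝓘(ℝ, ℝ × ℝ) I ∞ h (univ ×ˢ Ioo (-a) a) ∧
    (∀ t ∈ Ioo (-a) a, L.IsLeafPath (fun s => h (s, t))) ∧
    InjOn (fun s => h (s, 0)) (Ico 0 1) ∧
    (fun s => h (s, 0)) '' Ico 0 1 = F ∧
    ∀ t ∈ Ioo (-a) a, h (0, t) = τ t ∧ h (1, t) = τ (P t)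

/-- `c` is the linear monodromy of the closed leaf `F`: the linearized Poincaré return map is
`t ↦ c * t`. (The number `c` is independent of the transversal; reversing the sense in which `F`
is traversed replaces it by `c⁻¹`.) -/
def HasLinearMonodromy (L : LineFoliation I M) (F : Set M) (c : ℝ) : Prop :=
  ∃ (τ : ℝ → M) (P : ℝ → ℝ), L.IsReturnMap F τ P ∧ HasDerivAt P c 0

/-- `F` is a closed leaf with non-degenerate linear monodromy. -/
def IsNondegenerateClosedLeaf (L : LineFoliation I M) (F : Set M) : Prop :=
  (∃ x : M, F = L.leaf x) ∧ ∃ c : ℝ, 0 < c ∧ c ≠ 1 ∧ L.HasLinearMonodromy F c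

end LineFoliation

/-- The angular form `dθ` on the unit circle: `dθ = Im (z̄ dz)`, so that the velocity of
`t ↦ exp (i t)` has `dθ = 1`. -/
def angularForm (z : Circle) : TangentSpace (𝓡 1) z →ₗ[ℝ] ℝ where
  toFun v := ((starRingEnd ℂ) (z : ℂ) *
    (show ℂ from mfderiv (𝓡 1) 𝓘(ℝ, ℂ) (fun w : Circle => (w : ℂ)) z v)).im
  map_add' v w := by
    rw [map_add]
    exact (congrArg Complex.im (mul_add _ _ _)).trans (Complex.add_im _ _)
  map_smul' c v := by
    rw [map_smul]
    exact (congrArg Complex.im (mul_smul_comm c _ _)).trans (Complex.smul_im _ _)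

/-- The one-form `dr + k r dθ` on `S¹ × ℝ`, with coordinates `(θ, r)`. -/
def linearForm (k : ℝ) (p : Circle × ℝ) :
    TangentSpace ((𝓡 1).prod 𝓘(ℝ, ℝ)) p →ₗ[ℝ] ℝ :=
  (LinearMap.snd ℝ (TangentSpace (𝓡 1) p.1) ℝ : _ →ₗ[ℝ] ℝ) +
    (k * p.2) • (angularForm p.1 ∘ₗ LinearMap.fst ℝ (TangentSpace (𝓡 1) p.1) ℝ)

/-- `φ` is a diffeomorphism from the open set `φ.source` of `M` onto `S¹ × (-ε, ε)` that
identifies `F` with `S¹ × {0}`. -/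
structure IsAnnularChart {E H : Type*} [NormedAddCommGroup E] [NormedSpace ℝ E]
    [TopologicalSpace H] {I : ModelWithCorners ℝ E H}
    {M : Type*} [TopologicalSpace M] [ChartedSpace H M]
    (F : Set M) (ε : ℝ)
    (φ : PartialDiffeomorph I ((𝓡 1).prod 𝓘(ℝ, ℝ)) M (Circle × ℝ) ∞) : Prop where
  target_eq : φ.target = univ ×ˢ Ioo (-ε) ε
  preimage_core : φ.source ∩ φ ⁻¹' (univ ×ˢ {0}) = F

end

/-!
In the given annular coordinates, lifted to the plane by `annulusCover`, the foliation becomes a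
line field that is `2π`-periodic in the angle `θ`. The core `r = 0` is tangent to it
(`horizontal_mem_planarLine`), so by compactness it is nowhere vertical in a strip around the core,
where it is the direction field of an equation `dr/dθ = f(θ, r)` with `f` smooth, periodic and
`f(θ, 0) = 0` (`exists_slope`). By the variational equation the derivative of the return map is
determined by the mean of `a(θ) = ∂f/∂r (θ, 0)`: if the mean vanished, the linear monodromy would
be `1` (`integral_fderiv_slope_ne_zero`).

It remains to conjugate `dr/dθ = f(θ, r)` to `dρ/dθ = μ ρ`, where `μ ≠ 0` is the mean of `a`, by a
periodic substitution `r = B(θ, ρ)`, that is, to solve `∂B/∂θ + μ ρ ∂B/∂ρ = f(θ, B)`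
(`exists_linearizing_substitution`). The factor `e^A`, with `A` a periodic primitive of `a - μ`,
makes the linear part constant, and `B = e^A ρ p` leads to an equation for `p` in which the
nonlinearity has a factor `ρ`. Its characteristics are the orbits of the linear flow; every orbit
tends to the core in one of the two time directions, and integration from the core turns the
equation into an integral equation in `C([0, 1])`
(`exists_solution_along_linear_flow`). After the time change `z = e^{μ t / 2}` the integrand is
continuous up to `z = 0`, together with its derivatives in the unknown and in the parameters. The
integral operator is therefore a smooth map on a Banach space (`contDiff_superposition`), and the
contraction principle together with the implicit function theorem gives a solution that is smooth
in `(θ, ρ)`, on a strip that does not depend on the order of differentiability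
(`exists_smooth_solution`).

Since `∂B/∂ρ > 0` near the core, the substitution defines a diffeomorphism of annuli
(`exists_partialDiffeomorph_of_substitution`), and composition with the given chart maps the
foliation to the kernel of `dρ - μ ρ dθ` (`mem_direction_iff_modelLinearForm`).
-/

/-! ### Superposition operators on spaces of continuous functions -/

section Superposition

universe u v

/-- The superposition (Nemytskii) operator `p ↦ (x ↦ G x (p x))`. -/
def superposition {K P F : Type*} [TopologicalSpace K] [TopologicalSpace P] [TopologicalSpace F]
    (G : K → P → F) (hG : Continuous (Function.uncurry G)) (p : C(K, P)) : C(K, F) :=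
  ⟨fun x => G x (p x), hG.comp (continuous_id.prodMk p.continuous)⟩

theorem continuous_superposition {K P F : Type*} [TopologicalSpace K] [CompactSpace K]
    [TopologicalSpace P] [R1Space P] [TopologicalSpace F] (G : K → P → F)
    (hG : Continuous (Function.uncurry G)) : Continuous (superposition G hG) := by
  apply ContinuousMap.continuous_of_continuous_uncurry
  change Continuous fun q : C(K, P) × K => Function.uncurry G (q.2, q.1 q.2)
  exact hG.comp (continuous_snd.prodMk (ContinuousEval.continuous_eval))

variable {K : Type v} [TopologicalSpace K] {P : Type u} [NormedAddCommGroup P] [NormedSpace ℝ P]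

/-- `FiberContDiff n G`: the maps `G x : P → F` are `n` times differentiable, and their derivatives
up to order `n` are continuous functions of `(x, p)` jointly. The definition is by recursion on
`n`, passing from `F` to `P →L[ℝ] F`, so `P` and `F` live in the same universe. -/
def FiberContDiff : ∀ (_ : ℕ) {F : Type u} [NormedAddCommGroup F] [NormedSpace ℝ F]
    (_ : K → P → F), Prop
  | 0, _, _, _, G => Continuous (Function.uncurry G)
  | n + 1, F, _, _, G => Continuous (Function.uncurry G) ∧
      ∃ G' : K → P → P →L[ℝ] F, FiberContDiff n G' ∧ ∀ x p, HasFDerivAt (G x) (G' x p) p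

variable {F : Type u} [NormedAddCommGroup F] [NormedSpace ℝ F]

theorem FiberContDiff.continuous {n : ℕ} {G : K → P → F} (h : FiberContDiff n G) :
    Continuous (Function.uncurry G) := by
  cases n with
  | zero => exact h
  | succ n => exact h.1

variable [CompactSpace K]

/-- Pointwise application of a continuous family of linear maps. -/
noncomputable def pointwiseApply : C(K, P →L[ℝ] F) →L[ℝ] C(K, P) →L[ℝ] C(K, F) :=
  LinearMap.mkContinuous₂
    (LinearMap.mk₂ ℝ (fun (A : C(K, P →L[ℝ] F)) (v : C(K, P)) =>
      (⟨fun x => A x (v x), A.continuous.clm_apply v.continuous⟩ : C(K, F)))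
      (fun A B v => by ext x; simp) (fun c A v => by ext x; simp)
      (fun A v w => by ext x; simp) (fun c A v => by ext x; simp)) 1
    (fun A v => by
      rw [ContinuousMap.norm_le _ (by positivity)]
      intro x
      rw [one_mul]
      exact ((A x).le_opNorm _).trans
        (mul_le_mul (A.norm_coe_le_norm x) (v.norm_coe_le_norm x) (norm_nonneg _)
          (norm_nonneg (E := C(K, P →L[ℝ] F)) A)))

theorem hasFDerivAt_superposition {G : K → P → F} (hG : Continuous (Function.uncurry G))
    {G' : K → P → P →L[ℝ] F} (hG' : Continuous (Function.uncurry G'))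
    (h : ∀ x p, HasFDerivAt (G x) (G' x p) p) (p : C(K, P)) :
    HasFDerivAt (superposition G hG) (pointwiseApply (superposition G' hG' p)) p := by
  rw [hasFDerivAt_iff_isLittleO_nhds_zero, Asymptotics.isLittleO_iff]
  intro c hc
  -- Perturbing `p` by constant functions shows that `G' x w` is uniformly close to `G' x (p x)`
  -- for `w` uniformly close to `p x`.
  have hcont : ContinuousAt (superposition G' hG') p :=
    (continuous_superposition G' hG').continuousAt
  obtain ⟨η, hη, hη'⟩ := (Metric.continuousAt_iff (α := C(K, P))
    (β := C(K, P →L[ℝ] F))).1 hcont c hc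
  have key : ∀ x w, dist w (p x) < η → ‖G' x w - G' x (p x)‖ ≤ c := by
    intro x w hw
    have h1 : dist (p + ContinuousMap.const K (w - p x)) p < η := by
      rw [dist_eq_norm, add_sub_cancel_left]
      refine lt_of_le_of_lt ((ContinuousMap.norm_le _ (norm_nonneg (w - p x))).2
        fun y => le_rfl) (by rwa [← dist_eq_norm])
    have h2 := (ContinuousMap.dist_apply_le_dist (g := superposition G' hG' p) x).trans (hη' h1).le
    have h5 : superposition G' hG' (p + ContinuousMap.const K (w - p x)) x = G' x w := by
      change G' x (p x + (w - p x)) = G' x w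
      rw [add_sub_cancel]
    rw [dist_eq_norm, h5] at h2
    exact h2
  filter_upwards [Metric.ball_mem_nhds (0 : C(K, P)) hη] with v hv
  rw [ContinuousMap.norm_le _ (by positivity)]
  intro x
  have hvx : ‖v x‖ < η := lt_of_le_of_lt (v.norm_coe_le_norm x) (by simpa using hv)
  have hmem : p x + v x ∈ Metric.ball (p x) η := by simpa using hvx
  have h3 := (convex_ball (p x) η).norm_image_sub_le_of_norm_hasFDerivWithin_le'
    (f := G x) (f' := G' x) (φ := G' x (p x)) (C := c)
    (fun w _ => (h x w).hasFDerivWithinAt) (fun w hw => key x w hw)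
    (Metric.mem_ball_self hη) hmem
  have h4 : ‖G x (p x + v x) - G x (p x) - G' x (p x) (v x)‖ ≤ c * ‖v x‖ := by
    simpa using h3
  exact h4.trans (mul_le_mul_of_nonneg_left (v.norm_coe_le_norm x) hc.le)

theorem contDiff_superposition {n : ℕ} {F : Type u} [NormedAddCommGroup F] [NormedSpace ℝ F]
    {G : K → P → F} (h : FiberContDiff n G) : ContDiff ℝ n (superposition G h.continuous) := by
  induction n generalizing F with
  | zero => exact contDiff_zero.2 (continuous_superposition _ _)
  | succ n ih =>
    obtain ⟨hG, G', hG', hd⟩ := id h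
    rw [Nat.cast_succ, contDiff_succ_iff_hasFDerivAt]
    have hA : ContDiff ℝ n (pointwiseApply (K := K) (P := P) (F := F)) :=
      ContinuousLinearMap.contDiff _
    exact ⟨fun p => pointwiseApply (superposition G' hG'.continuous p),
      hA.comp (ih hG'),
      fun p => hasFDerivAt_superposition hG hG'.continuous hd p⟩

theorem contDiff_superposition_infty {G : K → P → F} (h : ∀ n, FiberContDiff n G) :
    ContDiff ℝ ∞ (superposition G (h 0).continuous) :=
  contDiff_infty.2 fun n => contDiff_superposition (h n)

end Superposition

/-! ### Smooth families of contractions -/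

section FixedPoint

open Filter Topology

variable {X : Type*} [NormedAddCommGroup X] [NormedSpace ℝ X]

theorem periodic_fderiv {E F : Type*} [NormedAddCommGroup E] [NormedSpace ℝ E]
    [NormedAddCommGroup F] [NormedSpace ℝ F] {f : E → F} {c : E} (hf : Function.Periodic f c) :
    Function.Periodic (fderiv ℝ f) c := fun x => by
  rw [← fderiv_comp_add_right c]
  exact congrArg (fun g => fderiv ℝ g x) (funext hf)

/-- The tube lemma for conditions that are periodic in the first variable. -/
theorem eventually_forall_of_periodic {Y : Type*} [TopologicalSpace Y] {p : ℝ → Y → Prop} {T : ℝ}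
    (hT : 0 < T) (hper : ∀ θ y, p (θ + T) y ↔ p θ y) {y₀ : Y}
    (h : ∀ θ, ∀ᶠ z : ℝ × Y in 𝓝 (θ, y₀), p z.1 z.2) : ∀ᶠ y in 𝓝 y₀, ∀ θ, p θ y := by
  have h1 : ∀ᶠ y in 𝓝 y₀, ∀ θ ∈ Icc 0 T, p θ y := by
    apply isCompact_Icc.eventually_forall_of_forall_eventually
    intro θ _
    exact (continuous_swap.tendsto (y₀, θ)).eventually (h θ)
  refine h1.mono fun y hy θ => ?_
  have hP : Function.Periodic (fun θ => p θ y) T := fun θ => propext (hper θ y)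
  obtain ⟨θ', hθ', h'⟩ := hP.exists_mem_Ico₀ hT θ
  rw [h']
  exact hy θ' (Ico_subset_Icc_self hθ')

/-- A function that is continuous on `ℝ × Y` and periodic in the real variable is locally bounded
in the second variable, uniformly in the first. -/
theorem eventually_forall_norm_lt_of_periodic {Y F : Type*} [TopologicalSpace Y]
    [NormedAddCommGroup F] {g : ℝ × Y → F} (hg : Continuous g) {T : ℝ} (hT : 0 < T)
    (hper : ∀ y, Function.Periodic (fun θ => g (θ, y)) T) (y₀ : Y) :
    ∃ C > 0, ∀ᶠ y in 𝓝 y₀, ∀ θ, ‖g (θ, y)‖ < C := by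
  obtain ⟨C, hC⟩ := (isCompact_Icc (a := (0 : ℝ)) (b := T)).exists_bound_of_continuousOn
    (f := fun θ => g (θ, y₀)) (by fun_prop)
  refine ⟨|C| + 1, by positivity, eventually_forall_of_periodic hT
    (p := fun θ y => ‖g (θ, y)‖ < |C| + 1) (fun θ y => ?_) fun θ => ?_⟩
  · rw [show g (θ + T, y) = g (θ, y) from hper y θ]
  · refine hg.norm.continuousAt.eventually_lt continuousAt_const ?_
    obtain ⟨θ', hθ', h'⟩ := (hper y₀).exists_mem_Ico₀ hT θ
    rw [h']
    have h1 := hC θ' (Ico_subset_Icc_self hθ')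
    have h2 := le_abs_self C
    linarith

/-- For small `ρ` the equation `q = q₀ + ρ H(θ, ρ, q)` has exactly one solution near `q₀`, and this
solution depends smoothly on `(θ, ρ)`; the bound on `ρ` is uniform in `θ` and does not depend on
the order of differentiability. -/
theorem exists_smooth_solution [CompleteSpace X] {H : ℝ × ℝ × X → X} (hH : ContDiff ℝ ∞ H)
    {T : ℝ} (hT : 0 < T) (hper : ∀ x, Function.Periodic (fun θ => H (θ, x)) T) (q₀ : X) :
    ∃ δ > 0, ∃ η > 0, ∃ q : ℝ × ℝ → X, ContDiffOn ℝ ∞ q (univ ×ˢ Ioo (-δ) δ) ∧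
      ∀ θ, ∀ ρ ∈ Ioo (-δ) δ, ‖q (θ, ρ) - q₀‖ ≤ η ∧ q (θ, ρ) = q₀ + ρ • H (θ, ρ, q (θ, ρ)) ∧
        ∀ q', ‖q' - q₀‖ ≤ η → q' = q₀ + ρ • H (θ, ρ, q') → q' = q (θ, ρ) := by
  obtain ⟨C₁, hC₁, hb₁⟩ := eventually_forall_norm_lt_of_periodic hH.continuous hT hper
    ((0 : ℝ), q₀)
  have hH' : Continuous (fderiv ℝ H) := hH.continuous_fderiv (by simp)
  have hperH : Function.Periodic H ((T, 0) : ℝ × ℝ × X) := by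
    rintro ⟨θ, x⟩
    simpa using hper x θ
  obtain ⟨C₂, hC₂, hb₂⟩ := eventually_forall_norm_lt_of_periodic hH' hT
    (fun x θ => by simpa using periodic_fderiv hperH (θ, x)) ((0 : ℝ), q₀)
  obtain ⟨r, hr, hb⟩ := Metric.eventually_nhds_iff_ball.1 (hb₁.and hb₂)
  obtain ⟨η, hη, hηr⟩ : ∃ η > 0, η < r := ⟨r / 2, by positivity, by linarith⟩
  set δ := min η (min (η / (2 * C₁)) (1 / (2 * C₂))) with hδ
  have hδ0 : 0 < δ := by positivity
  have hmem : ∀ ρ ∈ Ioo (-δ) δ, ∀ q, ‖q - q₀‖ ≤ η → (ρ, q) ∈ Metric.ball ((0 : ℝ), q₀) r := by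
    intro ρ hρ q hq
    have h1 : |ρ| < η := (abs_lt.2 hρ).trans_le (min_le_left _ _)
    rw [Metric.mem_ball, Prod.dist_eq, max_lt_iff]
    refine ⟨by simpa using h1.trans hηr, by rw [dist_eq_norm]; exact hq.trans_lt hηr⟩
  have hbd : ∀ θ, ∀ ρ ∈ Ioo (-δ) δ, ∀ q, ‖q - q₀‖ ≤ η → ‖ρ • H (θ, ρ, q)‖ ≤ η / 2 := by
    intro θ ρ hρ q hq
    have h1 : |ρ| ≤ η / (2 * C₁) :=
      (abs_lt.2 hρ).le.trans ((min_le_right _ _).trans (min_le_left _ _))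
    rw [norm_smul, Real.norm_eq_abs]
    calc |ρ| * ‖H (θ, ρ, q)‖ ≤ η / (2 * C₁) * C₁ :=
          mul_le_mul h1 ((hb _ (hmem ρ hρ q hq)).1 θ).le (norm_nonneg _) (by positivity)
      _ = η / 2 := by field_simp
  have hρC : ∀ ρ ∈ Ioo (-δ) δ, |ρ| * C₂ ≤ 1 / 2 := by
    intro ρ hρ
    have h1 : |ρ| ≤ 1 / (2 * C₂) :=
      (abs_lt.2 hρ).le.trans ((min_le_right _ _).trans (min_le_right _ _))
    calc |ρ| * C₂ ≤ 1 / (2 * C₂) * C₂ := mul_le_mul_of_nonneg_right h1 hC₂.le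
      _ = 1 / 2 := by field_simp
  -- the partial derivative in the direction of `X`
  have hder : ∀ θ ρ q, HasFDerivAt (fun q => H (θ, ρ, q))
      ((fderiv ℝ H (θ, ρ, q)).comp ((ContinuousLinearMap.inr ℝ ℝ (ℝ × X)).comp
        (ContinuousLinearMap.inr ℝ ℝ X))) q := by
    intro θ ρ q
    have h1 : HasFDerivAt H (fderiv ℝ H (θ, ρ, q)) (θ, ρ, q) :=
      (hH.differentiable (by simp) _).hasFDerivAt
    have h2 : HasFDerivAt (fun q : X => (θ, ρ, q)) ((ContinuousLinearMap.inr ℝ ℝ (ℝ × X)).comp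
        (ContinuousLinearMap.inr ℝ ℝ X)) q :=
      (hasFDerivAt_prodMk_right θ _).comp q (hasFDerivAt_prodMk_right ρ q)
    exact h1.comp q h2
  have hdn : ∀ θ, ∀ ρ ∈ Ioo (-δ) δ, ∀ q, ‖q - q₀‖ ≤ η →
      ‖(fderiv ℝ H (θ, ρ, q)).comp ((ContinuousLinearMap.inr ℝ ℝ (ℝ × X)).comp
        (ContinuousLinearMap.inr ℝ ℝ X))‖ ≤ C₂ := by
    intro θ ρ hρ q hq
    refine ContinuousLinearMap.opNorm_le_bound _ hC₂.le fun v => ?_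
    have h1 := (fderiv ℝ H (θ, ρ, q)).le_of_opNorm_le ((hb _ (hmem ρ hρ q hq)).2 θ).le
      ((0 : ℝ), (0 : ℝ), v)
    simpa [Prod.norm_def] using h1
  have hlip : ∀ θ, ∀ ρ ∈ Ioo (-δ) δ, ∀ q q', ‖q - q₀‖ ≤ η → ‖q' - q₀‖ ≤ η →
      ‖(q₀ + ρ • H (θ, ρ, q)) - (q₀ + ρ • H (θ, ρ, q'))‖ ≤ 1 / 2 * ‖q - q'‖ := by
    intro θ ρ hρ q q' hq hq'
    have h1 := (convex_closedBall q₀ η).norm_image_sub_le_of_norm_hasFDerivWithin_le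
      (f := fun q => H (θ, ρ, q)) (C := C₂) (fun w _ => (hder θ ρ w).hasFDerivWithinAt)
      (fun w hw => hdn θ ρ hρ w (by simpa [dist_eq_norm] using hw))
      (x := q') (y := q) (by simpa [dist_eq_norm] using hq') (by simpa [dist_eq_norm] using hq)
    rw [add_sub_add_left_eq_sub, ← smul_sub, norm_smul, Real.norm_eq_abs]
    calc |ρ| * ‖H (θ, ρ, q) - H (θ, ρ, q')‖ ≤ |ρ| * (C₂ * ‖q - q'‖) := by gcongr
      _ = |ρ| * C₂ * ‖q - q'‖ := by ring
      _ ≤ 1 / 2 * ‖q - q'‖ := by gcongr; exact hρC ρ hρ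
  have huniq : ∀ θ, ∀ ρ ∈ Ioo (-δ) δ, ∀ q q', ‖q - q₀‖ ≤ η → ‖q' - q₀‖ ≤ η →
      q = q₀ + ρ • H (θ, ρ, q) → q' = q₀ + ρ • H (θ, ρ, q') → q = q' := by
    intro θ ρ hρ q q' hq hq' h h'
    have h1 := hlip θ ρ hρ q q' hq hq'
    rw [← h, ← h'] at h1
    have h2 : ‖q - q'‖ = 0 := le_antisymm (by linarith) (norm_nonneg _)
    exact sub_eq_zero.1 (norm_eq_zero.1 h2)
  have hex : ∀ x : ℝ × ℝ, ∃ q, x.2 ∈ Ioo (-δ) δ →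
      ‖q - q₀‖ ≤ η ∧ q = q₀ + x.2 • H (x.1, x.2, q) := by
    rintro ⟨θ, ρ⟩
    by_cases hρ : ρ ∈ Ioo (-δ) δ
    swap
    · exact ⟨0, fun h => absurd h hρ⟩
    have hmaps : MapsTo (fun q => q₀ + ρ • H (θ, ρ, q)) (Metric.closedBall q₀ η)
        (Metric.closedBall q₀ η) := by
      intro q hq
      rw [mem_closedBall_iff_norm] at hq ⊢
      rw [add_sub_cancel_left]
      exact (hbd θ ρ hρ q hq).trans (by linarith)
    have hcontr : ContractingWith (1 / 2) (hmaps.restrict _ _ _) := by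
      refine ⟨by rw [← NNReal.coe_lt_coe]; norm_num, LipschitzWith.of_dist_le_mul ?_⟩
      rintro ⟨q, hq⟩ ⟨q', hq'⟩
      rw [mem_closedBall_iff_norm] at hq hq'
      have := hlip θ ρ hρ q q' hq hq'
      rw [Subtype.dist_eq, Subtype.dist_eq, dist_eq_norm, dist_eq_norm]
      simpa using this
    obtain ⟨q, hq, hfix, -⟩ := hcontr.exists_fixedPoint' Metric.isClosed_closedBall.isComplete hmaps
      (Metric.mem_closedBall_self hη.le) (edist_ne_top _ _)
    exact ⟨q, fun _ => ⟨mem_closedBall_iff_norm.1 hq, hfix.symm⟩⟩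
  choose q hq using hex
  refine ⟨δ, hδ0, η, hη, q, ?_, fun θ ρ hρ => ⟨(hq (θ, ρ) hρ).1, (hq (θ, ρ) hρ).2,
    fun q' h h' => huniq θ ρ hρ _ _ h (hq (θ, ρ) hρ).1 h' (hq (θ, ρ) hρ).2⟩⟩
  rintro ⟨θ, ρ⟩ ⟨-, hρ : ρ ∈ Ioo (-δ) δ⟩
  obtain ⟨hqη, hqeq⟩ := hq (θ, ρ) hρ
  dsimp only at hqeq
  -- The implicit function theorem applies because `1 - ρ ∂H/∂q` is invertible.
  let f : (ℝ × ℝ) × X → X := fun u => u.2 - q₀ - u.1.2 • H (u.1.1, u.1.2, u.2)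
  have hf : ContDiffAt ℝ ∞ f ((θ, ρ), q (θ, ρ)) := by
    have : ContDiff ℝ ∞ f := by
      have h1 : ContDiff ℝ ∞ fun u : (ℝ × ℝ) × X => H (u.1.1, u.1.2, u.2) :=
        hH.comp (by fun_prop)
      exact (contDiff_snd.sub contDiff_const).sub (ContDiff.smul (by fun_prop) h1)
    exact this.contDiffAt
  have hfinr : fderiv ℝ f ((θ, ρ), q (θ, ρ)) ∘L ContinuousLinearMap.inr ℝ (ℝ × ℝ) X =
      ContinuousLinearMap.id ℝ X - ρ • ((fderiv ℝ H (θ, ρ, q (θ, ρ))).comp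
        ((ContinuousLinearMap.inr ℝ ℝ (ℝ × X)).comp (ContinuousLinearMap.inr ℝ ℝ X))) := by
    have h1 : HasFDerivAt (fun x : X => f ((θ, ρ), x))
        (fderiv ℝ f ((θ, ρ), q (θ, ρ)) ∘L ContinuousLinearMap.inr ℝ (ℝ × ℝ) X) (q (θ, ρ)) :=
      (hf.differentiableAt (by simp)).hasFDerivAt.comp _ (hasFDerivAt_prodMk_right _ _)
    exact h1.unique (((hasFDerivAt_id _).sub_const _).sub ((hder θ ρ (q (θ, ρ))).const_smul ρ))
  have hinv : (fderiv ℝ f ((θ, ρ), q (θ, ρ)) ∘L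
      ContinuousLinearMap.inr ℝ (ℝ × ℝ) X).IsInvertible := by
    rw [hfinr]
    have hn : ‖ρ • ((fderiv ℝ H (θ, ρ, q (θ, ρ))).comp
        ((ContinuousLinearMap.inr ℝ ℝ (ℝ × X)).comp (ContinuousLinearMap.inr ℝ ℝ X)))‖ < 1 := by
      rw [norm_smul, Real.norm_eq_abs]
      have h1 := mul_le_mul_of_nonneg_left (hdn θ ρ hρ _ hqη) (abs_nonneg ρ)
      have h2 := hρC ρ hρ
      linarith
    exact ⟨ContinuousLinearEquiv.ofUnit (Units.oneSub _ hn), rfl⟩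
  have hi := hf.contDiffAt_implicitFunction (by simp) hinv
  refine (hi.congr_of_eventuallyEq ?_).contDiffWithinAt
  have h1 := hf.eventually_apply_implicitFunction (by simp) hinv
  have hself := hf.implicitFunction_apply_self (by simp) hinv
  have h2 : ∀ᶠ x in 𝓝 (θ, ρ), ‖hf.implicitFunction (by simp) hinv x - q₀‖ < η := by
    refine (hi.continuousAt.sub continuousAt_const).norm.eventually_lt continuousAt_const ?_
    rw [Pi.sub_apply, hself]
    have h3 : q (θ, ρ) - q₀ = ρ • H (θ, ρ, q (θ, ρ)) := by
      rw [sub_eq_iff_eq_add, add_comm]; exact hqeq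
    change ‖q (θ, ρ) - q₀‖ < η
    rw [h3]
    exact (hbd θ ρ hρ _ hqη).trans_lt (by linarith)
  have h3 : ∀ᶠ x : ℝ × ℝ in 𝓝 (θ, ρ), x.2 ∈ Ioo (-δ) δ :=
    continuous_snd.continuousAt.eventually_mem (isOpen_Ioo.mem_nhds hρ)
  have h0 : f ((θ, ρ), q (θ, ρ)) = 0 := by
    change q (θ, ρ) - q₀ - ρ • H (θ, ρ, q (θ, ρ)) = 0
    rw [sub_sub, ← hqeq, sub_self]
  filter_upwards [h1, h2, h3] with x hx1 hx2 hx3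
  rw [h0] at hx1
  refine huniq x.1 x.2 hx3 _ _ (hq x hx3).1 hx2.le (hq x hx3).2 ?_
  rw [← sub_eq_zero, ← sub_sub]
  exact hx1

end FixedPoint

/-! ### Parameter integrals and Hadamard's lemma -/

section Primitive

open MeasureTheory Filter Topology unitInterval

/-- The primitive `z ↦ ∫ y in 0..z, u y` of a continuous function on `[0, 1]`; the integrand is
extended to the line by `projIcc`. -/
noncomputable def primitive : C(I, ℝ) →L[ℝ] C(I, ℝ) :=
  LinearMap.mkContinuous
    { toFun := fun u => ⟨fun z => ∫ y in (0 : ℝ)..z, u (projIcc 0 1 zero_le_one y),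
        (intervalIntegral.continuous_primitive (fun a b => Continuous.intervalIntegrable
          (u.continuous.comp continuous_projIcc) a b) 0).comp continuous_subtype_val⟩
      map_add' := fun u v => by
        ext z
        exact intervalIntegral.integral_add
          (Continuous.intervalIntegrable (u.continuous.comp continuous_projIcc) _ _)
          (Continuous.intervalIntegrable (v.continuous.comp continuous_projIcc) _ _)
      map_smul' := fun c u => by
        ext z
        exact intervalIntegral.integral_smul c _ } 1
    (fun u => by
      rw [one_mul, ContinuousMap.norm_le _ (norm_nonneg _)]
      intro z
      refine (intervalIntegral.norm_integral_le_of_norm_le_const (C := ‖u‖)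
        fun y _ => u.norm_coe_le_norm _).trans ?_
      rw [sub_zero, abs_of_nonneg z.2.1]
      exact mul_le_of_le_one_right (norm_nonneg _) z.2.2)

/-- The constant functions, as a continuous linear map. -/
noncomputable def constCLM (K : Type*) [TopologicalSpace K] [CompactSpace K] (P : Type*)
    [NormedAddCommGroup P] [NormedSpace ℝ P] : P →L[ℝ] C(K, P) :=
  LinearMap.mkContinuous
    { toFun := fun p => ContinuousMap.const K p
      map_add' := fun _ _ => rfl
      map_smul' := fun _ _ => rfl } 1
    (fun p => by
      rw [one_mul, ContinuousMap.norm_le _ (norm_nonneg _)]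
      exact fun _ => le_rfl)

variable {P : Type} [NormedAddCommGroup P] [NormedSpace ℝ P]

theorem fiberContDiff_of_contDiff {F : Type} [NormedAddCommGroup F] [NormedSpace ℝ F]
    {S : ℝ × P → F} (hS : ContDiff ℝ ∞ S) (n : ℕ) :
    FiberContDiff n (fun (y : I) (p : P) => S (y, p)) := by
  have hc : ∀ {F : Type} [NormedAddCommGroup F] [NormedSpace ℝ F] {S : ℝ × P → F},
      ContDiff ℝ ∞ S → Continuous (Function.uncurry fun (y : I) (p : P) => S (y, p)) := by
    intro F _ _ S hS
    exact hS.continuous.comp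
      ((continuous_subtype_val.comp continuous_fst).prodMk continuous_snd)
  induction n generalizing F with
  | zero => exact hc hS
  | succ n ih =>
    refine ⟨hc hS, fun y p => (fderiv ℝ S (y, p)).comp (ContinuousLinearMap.inr ℝ ℝ P),
      ih (S := fun x => (fderiv ℝ S x).comp (ContinuousLinearMap.inr ℝ ℝ P))
        ((hS.fderiv_right (m := ∞) (by simp)).clm_comp contDiff_const), fun y p => ?_⟩
    exact ((hS.differentiable (by simp) _).hasFDerivAt).comp p (hasFDerivAt_prodMk_right _ _)

/-- An integral of a smooth function over `[0, 1]` depends smoothly on parameters: it is the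
integral of a superposition operator, evaluated at constant functions. -/
theorem contDiff_parameter_integral {S : ℝ × P → ℝ} (hS : ContDiff ℝ ∞ S) :
    ContDiff ℝ ∞ fun p => ∫ y in (0 : ℝ)..1, S (y, p) := by
  have h1 := contDiff_superposition_infty (fun n => fiberContDiff_of_contDiff hS n)
  have h2 : ContDiff ℝ ∞ (constCLM I P) := ContinuousLinearMap.contDiff _
  have h3 : ContDiff ℝ ∞ primitive := ContinuousLinearMap.contDiff _
  have h4 : ContDiff ℝ ∞ (ContinuousMap.evalCLM ℝ (1 : I) : C(I, ℝ) →L[ℝ] ℝ) :=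
    ContinuousLinearMap.contDiff _
  convert h4.comp (h3.comp (h1.comp h2)) using 1
  funext p
  refine intervalIntegral.integral_congr fun y hy => ?_
  rw [uIcc_of_le zero_le_one] at hy
  change S (y, p) = S (projIcc 0 1 zero_le_one y, p)
  rw [projIcc_of_mem zero_le_one hy]

/-- Hadamard's lemma: a smooth function vanishing on the line `r = 0` is `r` times a smooth
function, namely `∫ t in 0..1, ∂f/∂r (θ, t r)`. -/
theorem exists_smooth_eq_mul {f : ℝ × ℝ → ℝ} (hf : ContDiff ℝ ∞ f) (h0 : ∀ θ, f (θ, 0) = 0)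
    {T : ℝ} (hper : ∀ r, Function.Periodic (fun θ => f (θ, r)) T) :
    ∃ f₁ : ℝ × ℝ → ℝ, ContDiff ℝ ∞ f₁ ∧ (∀ θ r, f (θ, r) = r * f₁ (θ, r)) ∧
      (∀ r, Function.Periodic (fun θ => f₁ (θ, r)) T) := by
  have hS : ContDiff ℝ ∞ fun x : ℝ × ℝ × ℝ => fderiv ℝ f (x.2.1, x.1 * x.2.2) (0, 1) :=
    ((hf.fderiv_right (m := ∞) (by simp)).comp (by fun_prop)).clm_apply contDiff_const
  refine ⟨_, contDiff_parameter_integral hS, fun θ r => ?_, fun r θ => ?_⟩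
  · have hd : ∀ t : ℝ, HasDerivAt (fun t => f (θ, t * r))
        (r * fderiv ℝ f (θ, t * r) (0, 1)) t := by
      intro t
      have h1 : HasDerivAt (fun t : ℝ => (θ, t * r)) ((0 : ℝ), r) t :=
        (hasDerivAt_const t θ).prodMk (by simpa using (hasDerivAt_id t).mul_const r)
      have h2 := ((hf.differentiable (by simp) (θ, t * r)).hasFDerivAt).comp_hasDerivAt t h1
      have h3 : ((0 : ℝ), r) = r • ((0 : ℝ), (1 : ℝ)) := by simp
      rw [h3, map_smul, smul_eq_mul] at h2
      exact h2
    have h4 := intervalIntegral.integral_eq_sub_of_hasDerivAt (a := 0) (b := 1)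
      (fun t _ => hd t) (Continuous.intervalIntegrable (by
        have : Continuous fun t : ℝ => fderiv ℝ f (θ, t * r) (0, 1) :=
          hS.continuous.comp (by fun_prop : Continuous fun t : ℝ => (t, θ, r))
        fun_prop) _ _)
    rw [intervalIntegral.integral_const_mul] at h4
    rw [h4]
    simp [h0]
  · have hp : Function.Periodic f (T, 0) := by
      rintro ⟨θ, r⟩
      simpa using hper r θ
    refine intervalIntegral.integral_congr fun t _ => ?_
    have := periodic_fderiv hp (θ, t * r)
    simp only [Prod.mk_add_mk, add_zero] at this
    dsimp only
    rw [this]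

end Primitive

/-! ### The singular integral equation along the linear flow -/

section IntegralEquation

open MeasureTheory Filter Topology unitInterval

variable {P : Type} [NormedAddCommGroup P] [NormedSpace ℝ P]

/-- The rotation by `ν log y` oscillates as `y → 0`; for a periodic function the factor `y`
restores continuity at `y = 0`, and does so for all derivatives in the other variables. -/
theorem fiberContDiff_log_shift {F : Type} [NormedAddCommGroup F] [NormedSpace ℝ F]
    {S : ℝ × P → F} (hS : ContDiff ℝ ∞ S) {e : P} {T : ℝ} (hT : 0 < T)
    (hper : ∀ y p, S (y, p + T • e) = S (y, p)) (ν : ℝ) (n : ℕ) :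
    FiberContDiff n (fun (y : I) (p : P) => (y : ℝ) • S (y, p + (ν * Real.log y) • e)) := by
  have hc : ∀ {F : Type} [NormedAddCommGroup F] [NormedSpace ℝ F] {S : ℝ × P → F},
      ContDiff ℝ ∞ S → (∀ y p, S (y, p + T • e) = S (y, p)) →
      Continuous (Function.uncurry fun (y : I) (p : P) =>
        (y : ℝ) • S (y, p + (ν * Real.log y) • e)) := by
    intro F _ _ S hS hper
    have hSc := hS.continuous
    rw [continuous_iff_continuousAt]
    rintro ⟨y₀, p₀⟩
    have hy : Continuous fun x : I × P => (x.1 : ℝ) := continuous_subtype_val.comp continuous_fst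
    by_cases h0 : (y₀ : ℝ) = 0
    · obtain ⟨C, hC, hb⟩ := eventually_forall_norm_lt_of_periodic
        (g := fun x : ℝ × ℝ × P => S (x.2.1, x.2.2 + x.1 • e)) (by fun_prop) hT
        (fun x θ => by
          dsimp only
          rw [add_smul, ← add_assoc, hper]) ((y₀ : ℝ), p₀)
      have hb' : ∀ᶠ x : I × P in 𝓝 (y₀, p₀), ∀ θ : ℝ, ‖S (x.1, x.2 + θ • e)‖ < C :=
        ((hy.prodMk continuous_snd).tendsto (y₀, p₀)).eventually hb
      have hlim : Tendsto (fun x : I × P => (x.1 : ℝ) * C) (𝓝 (y₀, p₀)) (𝓝 0) := by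
        have h1 : Continuous fun x : I × P => (x.1 : ℝ) * C := hy.mul continuous_const
        simpa [h0] using h1.tendsto (y₀, p₀)
      rw [ContinuousAt]
      have hv : (Function.uncurry fun (y : I) (p : P) =>
          (y : ℝ) • S (y, p + (ν * Real.log y) • e)) (y₀, p₀) = 0 := by
        simp [h0]
      rw [hv]
      refine squeeze_zero_norm' (hb'.mono fun x hx => ?_) hlim
      change ‖(x.1 : ℝ) • S (x.1, x.2 + (ν * Real.log x.1) • e)‖ ≤ _
      rw [norm_smul, Real.norm_of_nonneg x.1.2.1]
      exact mul_le_mul_of_nonneg_left (hx _).le x.1.2.1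
    · have hl : ContinuousAt (fun x : I × P => Real.log x.1) (y₀, p₀) :=
        hy.continuousAt.log h0
      refine hy.continuousAt.smul (hSc.continuousAt.comp
        (hy.continuousAt.prodMk (continuousAt_snd.add
          ((continuousAt_const.mul hl).smul continuousAt_const))))
  induction n generalizing F with
  | zero => exact hc hS hper
  | succ n ih =>
    refine ⟨hc hS hper, fun y p => (y : ℝ) •
      (fderiv ℝ S (y, p + (ν * Real.log y) • e)).comp (ContinuousLinearMap.inr ℝ ℝ P),
      ih (S := fun x => (fderiv ℝ S x).comp (ContinuousLinearMap.inr ℝ ℝ P))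
        ((hS.fderiv_right (m := ∞) (by simp)).clm_comp contDiff_const) (fun y p => ?_),
      fun y p => ?_⟩
    · have hp : Function.Periodic S (0, T • e) := by
        rintro ⟨y, p⟩
        simpa using hper y p
      have := periodic_fderiv hp (y, p)
      simp only [Prod.mk_add_mk, add_zero] at this
      rw [this]
    · have h1 : HasFDerivAt (fun p : P => p + (ν * Real.log y) • e)
          (ContinuousLinearMap.id ℝ P) p := (hasFDerivAt_id p).add_const _
      have h2 := ((hS.differentiable (by simp)
        ((y : ℝ), p + (ν * Real.log y) • e)).hasFDerivAt).comp p
        ((hasFDerivAt_prodMk_right (y : ℝ) _).comp p h1)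
      exact h2.const_smul (y : ℝ)

/-- The map `(θ, ρ, q) ↦ (x ↦ (θ, ρ, q x))`. -/
noncomputable def parameterFamily : ℝ × ℝ × C(I, ℝ) →L[ℝ] C(I, ℝ × ℝ × ℝ) :=
  LinearMap.mkContinuous
    { toFun := fun a => ⟨fun x => (a.1, a.2.1, a.2.2 x), by fun_prop⟩
      map_add' := fun _ _ => rfl
      map_smul' := fun _ _ => rfl } 1
    (fun a => by
      rw [one_mul, ContinuousMap.norm_le _ (norm_nonneg _)]
      intro x
      simp only [Prod.norm_def, LinearMap.coe_mk, AddHom.coe_mk, ContinuousMap.coe_mk]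
      gcongr
      exact a.2.2.norm_coe_le_norm x)

/-- The integrand `y q² g(θ + ν log y, y² ρ q)` as a function of `y` and `a = (θ, ρ, q)`. -/
noncomputable def kernelIntegrand (g : ℝ × ℝ → ℝ) (ν y : ℝ) (a : ℝ × ℝ × ℝ) : ℝ :=
  y * (a.2.2 ^ 2 * g (a.1 + ν * Real.log y, y ^ 2 * a.2.1 * a.2.2))

theorem fiberContDiff_kernelIntegrand {g : ℝ × ℝ → ℝ} (hg : ContDiff ℝ ∞ g) {T : ℝ} (hT : 0 < T)
    (hper : ∀ r, Function.Periodic (fun θ => g (θ, r)) T) (ν : ℝ) (n : ℕ) :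
    FiberContDiff n (fun (y : I) (a : ℝ × ℝ × ℝ) => kernelIntegrand g ν y a) := by
  have h := fiberContDiff_log_shift
    (S := fun x : ℝ × ℝ × ℝ × ℝ => x.2.2.2 ^ 2 * g (x.2.1, x.1 ^ 2 * x.2.2.1 * x.2.2.2))
    ((by fun_prop : ContDiff ℝ ∞ fun x : ℝ × ℝ × ℝ × ℝ => x.2.2.2 ^ 2).mul
      (hg.comp (by fun_prop))) (e := ((1 : ℝ), (0 : ℝ), (0 : ℝ))) hT (fun y a => by
        have := hper (y ^ 2 * a.2.1 * a.2.2) a.1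
        simp_all) ν n
  refine (congrArg (FiberContDiff n) ?_).mpr h
  funext y a
  simp [kernelIntegrand]

/-- The equation `ν ∂p/∂θ + 2 ρ ∂p/∂ρ = ν ρ p² g(θ, ρ p)` with `p = 1` on `ρ = 0` has a smooth
periodic solution near `ρ = 0`. Along the orbit `z ↦ (θ + ν log z, ρ z²)` of the characteristic
field, which tends to `ρ = 0` as `z → 0`, the equation becomes the integral equation
`q(z) = 1 + ν ρ ∫ y in 0..z, y q(y)² g(θ + ν log y, y² ρ q(y))` for `q(z) = p(θ + ν log z, ρ z²)`.
It is solved in `C([0, 1])` by the contraction principle with parameters, and `p = q(1)`. -/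
theorem exists_solution_along_linear_flow {g : ℝ × ℝ → ℝ} (hg : ContDiff ℝ ∞ g) {T : ℝ}
    (hT : 0 < T) (hper : ∀ r, Function.Periodic (fun θ => g (θ, r)) T) (ν : ℝ) :
    ∃ δ > 0, ∃ p : ℝ × ℝ → ℝ, ContDiffOn ℝ ∞ p (univ ×ˢ Ioo (-δ) δ) ∧ (∀ θ, p (θ, 0) = 1) ∧
      ∀ θ, ∀ ρ ∈ Ioo (-δ) δ, p (θ + T, ρ) = p (θ, ρ) ∧
        fderiv ℝ p (θ, ρ) (ν, 2 * ρ) = ν * ρ * p (θ, ρ) ^ 2 * g (θ, ρ * p (θ, ρ)) := by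
  set N : C(I, ℝ × ℝ × ℝ) → C(I, ℝ) := superposition _
    (fiberContDiff_kernelIntegrand hg hT hper ν 0).continuous with hN
  have hNs : ContDiff ℝ ∞ N :=
    contDiff_superposition_infty fun n => fiberContDiff_kernelIntegrand hg hT hper ν n
  set H : ℝ × ℝ × C(I, ℝ) → C(I, ℝ) := fun a => ν • primitive (N (parameterFamily a)) with hH
  have hHs : ContDiff ℝ ∞ H := by
    have h2 : ContDiff ℝ ∞ parameterFamily := ContinuousLinearMap.contDiff _
    have h3 : ContDiff ℝ ∞ primitive := ContinuousLinearMap.contDiff _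
    have h4 : ContDiff ℝ ∞ fun a => primitive (N (parameterFamily a)) := h3.comp (hNs.comp h2)
    exact h4.const_smul ν
  have hHval : ∀ θ ρ (q : C(I, ℝ)) (x : I), H (θ, ρ, q) x = ν * ∫ y in (0 : ℝ)..x,
      kernelIntegrand g ν (projIcc 0 1 zero_le_one y) (θ, ρ, q (projIcc 0 1 zero_le_one y)) :=
    fun θ ρ q x => rfl
  have hHper : ∀ x, Function.Periodic (fun θ => H (θ, x)) T := by
    rintro ⟨ρ, q⟩ θ
    ext x
    dsimp only
    rw [hHval, hHval]
    congr 2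
    funext y
    have := hper ((projIcc 0 1 zero_le_one y : ℝ) ^ 2 * ρ * q (projIcc 0 1 zero_le_one y))
      (θ + ν * Real.log (projIcc 0 1 zero_le_one y : ℝ))
    dsimp only at this
    simp only [kernelIntegrand]
    rw [← this, add_right_comm]
  obtain ⟨δ, hδ, η, hη, q, hqs, hq⟩ := exists_smooth_solution hHs hT hHper 1
  have hqval : ∀ θ, ∀ ρ ∈ Ioo (-δ) δ, ∀ x : I, q (θ, ρ) x = 1 + ρ * (ν * ∫ y in (0 : ℝ)..x,
      kernelIntegrand g ν (projIcc 0 1 zero_le_one y)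
        (θ, ρ, q (θ, ρ) (projIcc 0 1 zero_le_one y))) := by
    intro θ ρ hρ x
    have h1 := congrArg (fun u : C(I, ℝ) => u x) (hq θ ρ hρ).2.1
    exact h1
  -- The equation is invariant under the linear flow `(θ, ρ) ↦ (θ + ν log z, ρ z²)`, so by
  -- uniqueness `q (θ, ρ)` records the values of `p` along the whole orbit.
  have hscale : ∀ θ, ∀ ρ ∈ Ioo (-δ) δ, ∀ z : I, 0 < (z : ℝ) →
      q (θ + ν * Real.log z, ρ * (z : ℝ) ^ 2) 1 = q (θ, ρ) z := by
    intro θ ρ hρ z hz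
    have hρz : ρ * (z : ℝ) ^ 2 ∈ Ioo (-δ) δ := by
      have h1 : (z : ℝ) ^ 2 ≤ 1 := pow_le_one₀ z.2.1 z.2.2
      have h2 : |ρ * (z : ℝ) ^ 2| < δ := by
        rw [abs_mul, abs_of_nonneg (sq_nonneg (z : ℝ))]
        exact (mul_le_of_le_one_right (abs_nonneg _) h1).trans_lt (abs_lt.2 hρ)
      exact abs_lt.1 h2
    let q' : C(I, ℝ) := (q (θ, ρ)).comp ⟨fun x => x * z, by fun_prop⟩
    have h := (hq (θ + ν * Real.log z) (ρ * (z : ℝ) ^ 2) hρz).2.2 q' ?_ ?_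
    · rw [← h]
      change q (θ, ρ) (1 * z) = _
      rw [one_mul]
    · rw [ContinuousMap.norm_le _ hη.le]
      intro x
      exact ((q (θ, ρ) - 1).norm_coe_le_norm (x * z)).trans (hq θ ρ hρ).1
    · ext x
      change q (θ, ρ) (x * z) = 1 + ρ * (z : ℝ) ^ 2 * H (θ + ν * Real.log z, ρ * (z : ℝ) ^ 2, q') x
      rw [hqval θ ρ hρ, hHval]
      have hsub := intervalIntegral.mul_integral_comp_mul_left (a := 0) (b := (x : ℝ))
        (f := fun y : ℝ => kernelIntegrand g ν (projIcc 0 1 zero_le_one y)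
          (θ, ρ, q (θ, ρ) (projIcc 0 1 zero_le_one y))) (z : ℝ)
      rw [mul_zero] at hsub
      rw [show ((x * z : I) : ℝ) = (z : ℝ) * x by rw [mul_comm]; rfl, ← hsub]
      have hint : ∫ y in (0 : ℝ)..x, kernelIntegrand g ν (projIcc 0 1 zero_le_one ((z : ℝ) * y))
          (θ, ρ, q (θ, ρ) (projIcc 0 1 zero_le_one ((z : ℝ) * y))) =
          ∫ y in (0 : ℝ)..x, (z : ℝ) * kernelIntegrand g ν (projIcc 0 1 zero_le_one y)
            (θ + ν * Real.log z, ρ * (z : ℝ) ^ 2, q' (projIcc 0 1 zero_le_one y)) := by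
        refine intervalIntegral.integral_congr fun y hy => ?_
        rw [uIcc_of_le x.2.1] at hy
        have hy1 : y ∈ Icc (0 : ℝ) 1 := ⟨hy.1, hy.2.trans x.2.2⟩
        have hy2 : (z : ℝ) * y ∈ Icc (0 : ℝ) 1 :=
          ⟨mul_nonneg z.2.1 hy1.1, mul_le_one₀ z.2.2 hy1.1 hy1.2⟩
        rw [projIcc_of_mem zero_le_one hy1, projIcc_of_mem zero_le_one hy2]
        have hqq : q' ⟨y, hy1⟩ = q (θ, ρ) ⟨(z : ℝ) * y, hy2⟩ := by
          change q (θ, ρ) (⟨y, hy1⟩ * z) = _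
          congr 1
          exact Subtype.ext (mul_comm _ _)
        rw [hqq]
        simp only [kernelIntegrand]
        rcases eq_or_ne y 0 with rfl | hy0
        · simp
        · rw [Real.log_mul hz.ne' hy0]
          ring_nf
      rw [hint, intervalIntegral.integral_const_mul]
      ring
  refine ⟨δ, hδ, fun a => q a 1, ?_, fun θ => ?_, fun θ ρ hρ => ⟨?_, ?_⟩⟩
  · have h4 : ContDiff ℝ ∞ (ContinuousMap.evalCLM ℝ (1 : I) : C(I, ℝ) →L[ℝ] ℝ) :=
      ContinuousLinearMap.contDiff _
    exact h4.comp_contDiffOn hqs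
  · dsimp only
    rw [hqval θ 0 ⟨by linarith, hδ⟩]
    simp
  · have h := (hq θ ρ hρ).2.2 (q (θ + T, ρ)) (hq (θ + T) ρ hρ).1 (by
      have h1 := (hq (θ + T) ρ hρ).2.1
      rwa [show H (θ + T, ρ, q (θ + T, ρ)) = H (θ, ρ, q (θ + T, ρ)) from hHper _ _] at h1)
    dsimp only
    rw [h]
  · have h4 : ContDiff ℝ ∞ (ContinuousMap.evalCLM ℝ (1 : I) : C(I, ℝ) →L[ℝ] ℝ) :=
      ContinuousLinearMap.contDiff _
    have hopen : IsOpen ((univ : Set ℝ) ×ˢ Ioo (-δ) δ) := isOpen_univ.prod isOpen_Ioo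
    have hpd : DifferentiableAt ℝ (fun a => q a 1) (θ, ρ) :=
      ((h4.comp_contDiffOn hqs).contDiffAt (hopen.mem_nhds ⟨mem_univ _, hρ⟩)).differentiableAt
        (by simp)
    have hcurve : HasDerivAt (fun z : ℝ => (θ + ν * Real.log z, ρ * z ^ 2)) (ν, 2 * ρ) 1 := by
      refine HasDerivAt.prodMk ?_ ?_
      · simpa using ((Real.hasDerivAt_log one_ne_zero).const_mul ν).const_add θ
      · have := (hasDerivAt_pow 2 (1 : ℝ)).const_mul ρ
        simpa [mul_comm] using this
    have hpd' : HasFDerivAt (fun a => q a 1) (fderiv ℝ (fun a => q a 1) (θ, ρ))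
        ((fun z : ℝ => (θ + ν * Real.log z, ρ * z ^ 2)) 1) := by
      simpa using hpd.hasFDerivAt
    have hd1 := hpd'.comp_hasDerivAt 1 hcurve
    have hcont : Continuous fun y : ℝ => kernelIntegrand g ν (projIcc 0 1 zero_le_one y)
        (θ, ρ, q (θ, ρ) (projIcc 0 1 zero_le_one y)) :=
      (N (parameterFamily (θ, ρ, q (θ, ρ)))).continuous.comp continuous_projIcc
    have hd2 : HasDerivAt (fun z : ℝ => 1 + ρ * (ν * ∫ y in (0 : ℝ)..z,
        kernelIntegrand g ν (projIcc 0 1 zero_le_one y)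
        (θ, ρ, q (θ, ρ) (projIcc 0 1 zero_le_one y)))) _ 1 :=
      (((intervalIntegral.integral_hasDerivAt_right (hcont.intervalIntegrable _ _)
        (hcont.stronglyMeasurableAtFilter _ _)
        hcont.continuousAt).const_mul ν).const_mul ρ).const_add 1
    -- The orbit through `(θ, ρ)` is only controlled for `z ≤ 1`, so derivatives at `z = 1` are
    -- compared within `(0, 1]`.
    have heq : EqOn (fun z : ℝ => 1 + ρ * (ν * ∫ y in (0 : ℝ)..z,
        kernelIntegrand g ν (projIcc 0 1 zero_le_one y)
        (θ, ρ, q (θ, ρ) (projIcc 0 1 zero_le_one y))))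
        ((fun a => q a 1) ∘ fun z : ℝ => (θ + ν * Real.log z, ρ * z ^ 2)) (Ioc 0 1) := by
      intro z hz
      have h1 := hscale θ ρ hρ ⟨z, hz.1.le, hz.2⟩ hz.1
      rw [hqval θ ρ hρ] at h1
      exact h1.symm
    have hu : UniqueDiffWithinAt ℝ (Ioc (0 : ℝ) 1) 1 :=
      uniqueDiffOn_Ioc 0 1 1 ⟨zero_lt_one, le_rfl⟩
    have h5 := hu.eq_deriv _ hd1.hasDerivWithinAt
      (hd2.hasDerivWithinAt.congr (fun z hz => (heq hz).symm)
        (heq ⟨zero_lt_one, le_rfl⟩).symm)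
    rw [h5, projIcc_of_mem zero_le_one ⟨zero_le_one, le_rfl⟩]
    simp only [kernelIntegrand]
    simp only [Real.log_one, mul_zero, add_zero, one_pow, one_mul]
    change ρ * (ν * (q (θ, ρ) 1 ^ 2 * g (θ, ρ * q (θ, ρ) 1))) =
      ν * ρ * q (θ, ρ) 1 ^ 2 * g (θ, ρ * q (θ, ρ) 1)
    ring

end IntegralEquation

/-! ### Linearization of a planar periodic equation -/

section Linearization

open MeasureTheory Filter Topology

/-- A periodic function becomes, after subtraction of its mean, the derivative of a periodic
function. -/
theorem exists_periodic_primitive {a : ℝ → ℝ} (ha : ContDiff ℝ ∞ a) {T : ℝ} (hT : 0 < T)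
    (hper : Function.Periodic a T) :
    ∃ A : ℝ → ℝ, ContDiff ℝ ∞ A ∧ Function.Periodic A T ∧
      ∀ θ, HasDerivAt A (a θ - (∫ t in (0 : ℝ)..T, a t) / T) θ := by
  set μ := (∫ t in (0 : ℝ)..T, a t) / T with hμ
  have hd : ∀ θ, HasDerivAt (fun θ => (∫ t in (0 : ℝ)..θ, a t) - μ * θ) (a θ - μ) θ := by
    intro θ
    have h1 : HasDerivAt (fun θ => ∫ t in (0 : ℝ)..θ, a t) (a θ) θ :=
      intervalIntegral.integral_hasDerivAt_right (ha.continuous.intervalIntegrable _ _)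
        (ha.continuous.stronglyMeasurableAtFilter _ _) ha.continuous.continuousAt
    exact (h1.sub ((hasDerivAt_id θ).const_mul μ)).congr_deriv (by simp)
  refine ⟨_, contDiff_infty_iff_deriv.2 ⟨fun θ => (hd θ).differentiableAt, ?_⟩, fun θ => ?_, hd⟩
  · rw [funext fun θ => (hd θ).deriv]
    exact ha.sub contDiff_const
  · have h1 := hper.intervalIntegral_add_eq θ 0
    have h2 := intervalIntegral.integral_add_adjacent_intervals
      (ha.continuous.intervalIntegrable (μ := volume) 0 θ)
      (ha.continuous.intervalIntegrable (μ := volume) θ (θ + T))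
    rw [zero_add] at h1
    have h3 : μ * T = ∫ t in (0 : ℝ)..T, a t := by rw [hμ]; field_simp
    dsimp only
    rw [← h2, h1, ← h3]
    ring

/-- The equation `dr/dθ = f(θ, r)` near its solution `r = 0` becomes `dρ/dθ = μ ρ` under a
substitution `r = B(θ, ρ)`, provided the mean of `∂f/∂r (θ, 0)` does not vanish. Writing
`f = r a(θ) + r² b(θ, r)` and `a - μ = A'` with `A` periodic, the function `B = e^A ρ p` satisfies
`∂B/∂θ + μ ρ ∂B/∂ρ = f(θ, B)` if and only if `p` solves the equation of
`exists_solution_along_linear_flow` with `g(θ, u) = e^A b(θ, e^A u)` and `ν = 2 / μ`. -/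
theorem exists_linearizing_substitution {f : ℝ × ℝ → ℝ} (hf : ContDiff ℝ ∞ f)
    (h0 : ∀ θ, f (θ, 0) = 0) {T : ℝ} (hT : 0 < T)
    (hper : ∀ r, Function.Periodic (fun θ => f (θ, r)) T)
    (hmean : ∫ θ in (0 : ℝ)..T, fderiv ℝ f (θ, 0) (0, 1) ≠ 0) {ε : ℝ} (hε : 0 < ε) :
    ∃ μ : ℝ, μ ≠ 0 ∧ ∃ δ > 0, ∃ B : ℝ × ℝ → ℝ, ContDiffOn ℝ ∞ B (univ ×ˢ Ioo (-δ) δ) ∧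
      (∀ θ, B (θ, 0) = 0) ∧ ∀ θ, ∀ ρ ∈ Ioo (-δ) δ, B (θ + T, ρ) = B (θ, ρ) ∧
        B (θ, ρ) ∈ Ioo (-ε) ε ∧ 0 < fderiv ℝ B (θ, ρ) (0, 1) ∧
        fderiv ℝ B (θ, ρ) (1, μ * ρ) = f (θ, B (θ, ρ)) := by
  obtain ⟨f₁, hf₁, hff₁, hf₁per⟩ := exists_smooth_eq_mul hf h0 hper
  have ha : ∀ θ, fderiv ℝ f (θ, 0) (0, 1) = f₁ (θ, 0) := by
    intro θ
    have h1 : HasDerivAt (fun r => f (θ, r)) (fderiv ℝ f (θ, 0) (0, 1)) 0 :=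
      (hf.differentiable (by simp) (θ, 0)).hasFDerivAt.comp_hasDerivAt 0
        ((hasDerivAt_const 0 θ).prodMk (hasDerivAt_id 0))
    have h2 : HasDerivAt (fun r => f₁ (θ, r)) (fderiv ℝ f₁ (θ, 0) (0, 1)) 0 :=
      (hf₁.differentiable (by simp) (θ, 0)).hasFDerivAt.comp_hasDerivAt 0
        ((hasDerivAt_const 0 θ).prodMk (hasDerivAt_id 0))
    have h3 := (hasDerivAt_id (0 : ℝ)).mul h2
    rw [show (fun r => f (θ, r)) = id * fun r => f₁ (θ, r) from funext fun r => hff₁ θ r] at h1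
    simpa using h1.unique h3
  obtain ⟨b, hb, hfb, hbper⟩ := exists_smooth_eq_mul (f := fun x => f₁ x - f₁ (x.1, 0))
    (hf₁.sub (hf₁.comp (by fun_prop))) (fun θ => sub_self _) (T := T) (fun r θ => by
      dsimp only
      rw [show f₁ (θ + T, r) = f₁ (θ, r) from hf₁per r θ,
        show f₁ (θ + T, 0) = f₁ (θ, 0) from hf₁per 0 θ])
  obtain ⟨A, hA, hAper, hAd⟩ := exists_periodic_primitive (a := fun θ => f₁ (θ, 0))
    (hf₁.comp (by fun_prop)) hT (hf₁per 0)
  simp only [ha] at hmean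
  set μ := (∫ t in (0 : ℝ)..T, f₁ (t, 0)) / T with hμ
  have hμ0 : μ ≠ 0 := div_ne_zero hmean hT.ne'
  have hfab : ∀ θ r, f (θ, r) = r * f₁ (θ, 0) + r ^ 2 * b (θ, r) := by
    intro θ r
    have := hfb θ r
    dsimp only at this
    rw [hff₁, sub_eq_iff_eq_add.1 this]
    ring
  obtain ⟨δ₀, hδ₀, p, hp, hp0, hpe⟩ := exists_solution_along_linear_flow
    (g := fun x => Real.exp (A x.1) * b (x.1, x.2 * Real.exp (A x.1)))
    ((by fun_prop : ContDiff ℝ ∞ fun x : ℝ × ℝ => Real.exp (A x.1)).mul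
      (hb.comp (by fun_prop))) hT (fun r θ => by
        dsimp only
        rw [hAper θ, show b (θ + T, r * Real.exp (A θ)) = b (θ, r * Real.exp (A θ)) from
          hbper _ θ]) (2 / μ)
  have hopen : IsOpen ((univ : Set ℝ) ×ˢ Ioo (-δ₀) δ₀) := isOpen_univ.prod isOpen_Ioo
  set B : ℝ × ℝ → ℝ := fun x => Real.exp (A x.1) * (x.2 * p x) with hB
  have hBs : ContDiffOn ℝ ∞ B (univ ×ˢ Ioo (-δ₀) δ₀) :=
    (by fun_prop : ContDiff ℝ ∞ fun x : ℝ × ℝ => Real.exp (A x.1)).contDiffOn.mul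
      (contDiff_snd.contDiffOn.mul hp)
  have hBd : ∀ θ, ∀ ρ ∈ Ioo (-δ₀) δ₀, ∀ v, fderiv ℝ B (θ, ρ) v = Real.exp (A θ) *
      ((f₁ (θ, 0) - μ) * v.1 * (ρ * p (θ, ρ)) + (v.2 * p (θ, ρ) + ρ * fderiv ℝ p (θ, ρ) v)) := by
    intro θ ρ hρ v
    have h1 : HasFDerivAt p (fderiv ℝ p (θ, ρ)) (θ, ρ) :=
      ((hp.contDiffAt (hopen.mem_nhds ⟨mem_univ _, hρ⟩)).differentiableAt (by simp)).hasFDerivAt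
    have h2 : HasFDerivAt (fun t => Real.exp (A t)) _ (Prod.fst (θ, ρ)) := (hAd θ).exp.hasFDerivAt
    have h3 := (h2.comp (θ, ρ) hasFDerivAt_fst).mul
      ((hasFDerivAt_snd (𝕜 := ℝ) (p := (θ, ρ))).mul h1)
    have h4 : fderiv ℝ B (θ, ρ) = _ := HasFDerivAt.fderiv h3
    rw [h4]
    simp
    ring
  have hBper : ∀ θ, ∀ ρ ∈ Ioo (-δ₀) δ₀, B (θ + T, ρ) = B (θ, ρ) := by
    intro θ ρ hρ
    simp only [hB]
    rw [hAper θ, (hpe θ ρ hρ).1]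
  have hB0 : ∀ θ, B (θ, 0) = 0 := by simp [hB]
  have htube : ∀ᶠ ρ in 𝓝 (0 : ℝ), ∀ θ, ρ ∈ Ioo (-δ₀) δ₀ ∧ B (θ, ρ) ∈ Ioo (-ε) ε ∧
      0 < fderiv ℝ B (θ, ρ) (0, 1) := by
    refine eventually_forall_of_periodic (p := fun θ ρ => ρ ∈ Ioo (-δ₀) δ₀ ∧
      B (θ, ρ) ∈ Ioo (-ε) ε ∧ 0 < fderiv ℝ B (θ, ρ) (0, 1)) hT (fun θ ρ => ?_) fun θ => ?_
    · refine and_congr_right fun hρ => ?_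
      have h1 : fderiv ℝ B (θ + T, ρ) = fderiv ℝ B (θ, ρ) := by
        have h2 := fderiv_comp_add_right (𝕜 := ℝ) (f := B) (x := (θ, ρ)) (T, 0)
        rw [Prod.mk_add_mk, add_zero] at h2
        rw [← h2]
        refine Filter.EventuallyEq.fderiv_eq ?_
        filter_upwards [hopen.mem_nhds (⟨mem_univ _, hρ⟩ : (θ, ρ) ∈ univ ×ˢ Ioo (-δ₀) δ₀)]
          with x hx
        rw [show x + (T, 0) = (x.1 + T, x.2) by ext <;> simp]
        exact hBper x.1 x.2 hx.2
      rw [hBper θ ρ hρ, h1]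
    · have hmem : ((θ, 0) : ℝ × ℝ) ∈ univ ×ˢ Ioo (-δ₀) δ₀ := ⟨mem_univ _, by linarith, hδ₀⟩
      have h1 : ContinuousAt B (θ, 0) := (hBs.contDiffAt (hopen.mem_nhds hmem)).continuousAt
      have h2 : ContinuousAt (fun x => fderiv ℝ B x (0, 1)) (θ, 0) :=
        ((hBs.contDiffAt (hopen.mem_nhds hmem)).fderiv_right (m := ∞)
          (by simp)).continuousAt.clm_apply continuousAt_const
      have h3 : 0 < fderiv ℝ B (θ, 0) (0, 1) := by
        rw [hBd θ 0 hmem.2, hp0]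
        simpa using Real.exp_pos _
      have h4 : B (θ, 0) ∈ Ioo (-ε) ε := by
        rw [hB0]
        exact ⟨neg_lt_zero.2 hε, hε⟩
      filter_upwards [hopen.mem_nhds hmem, h1.eventually_mem (isOpen_Ioo.mem_nhds h4),
        h2.eventually_const_lt h3] with x hx hx1 hx2
      exact ⟨hx.2, hx1, hx2⟩
  obtain ⟨δ, hδ, hball⟩ := Metric.eventually_nhds_iff_ball.1 htube
  rw [Real.ball_eq_Ioo, zero_sub, zero_add] at hball
  refine ⟨μ, hμ0, δ, hδ, B, hBs.mono (prod_mono subset_rfl fun ρ hρ => (hball ρ hρ 0).1), hB0,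
    fun θ ρ hρ => ⟨hBper θ ρ (hball ρ hρ θ).1, (hball ρ hρ θ).2.1, (hball ρ hρ θ).2.2, ?_⟩⟩
  rw [hBd θ ρ (hball ρ hρ θ).1]
  have h1 : fderiv ℝ p (θ, ρ) (1, μ * ρ) = μ / 2 * fderiv ℝ p (θ, ρ) (2 / μ, 2 * ρ) := by
    have h2 : ((1 : ℝ), μ * ρ) = (μ / 2) • ((2 / μ : ℝ), 2 * ρ) := by
      ext
      · simp only [Prod.smul_mk, smul_eq_mul]
        field_simp
      · simp only [Prod.smul_mk, smul_eq_mul]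
        ring
    rw [h2, map_smul, smul_eq_mul]
  rw [h1, (hpe θ ρ (hball ρ hρ θ).1).2, hfab]
  simp only [hB]
  rw [mul_comm (ρ * p (θ, ρ)) (Real.exp (A θ))]
  field_simp
  ring

end Linearization

/-! ### Local angles on the circle and the annulus -/

section Annulus

open Filter Topology

/-- The branch of the angle on the circle that takes the value `θ₀` at `exp (i θ₀)`; it is smooth
away from the antipodal point. -/
noncomputable def angleNear (θ₀ : ℝ) (z : Circle) : ℝ :=
  θ₀ + Complex.arg ((z * (Circle.exp θ₀)⁻¹ : Circle) : ℂ)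

theorem exp_angleNear (θ₀ : ℝ) (z : Circle) : Circle.exp (angleNear θ₀ z) = z := by
  rw [angleNear, Circle.exp_add, Circle.exp_arg, mul_comm, inv_mul_cancel_right]

theorem angleNear_exp {θ₀ θ : ℝ} (h : |θ - θ₀| < Real.pi) : angleNear θ₀ (Circle.exp θ) = θ := by
  rw [abs_lt] at h
  rw [angleNear, ← Circle.exp_neg, ← Circle.exp_add, ← sub_eq_add_neg, Circle.arg_exp h.1 h.2.le]
  ring

/-- The complement of the point antipodal to `exp (i θ₀)`. -/
def arcNear (θ₀ : ℝ) : Set Circle :=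
  {z | ((z * (Circle.exp θ₀)⁻¹ : Circle) : ℂ) ∈ Complex.slitPlane}

theorem contMDiff_circle_coe : ContMDiff (𝓡 1) 𝓘(ℝ, ℂ) ∞ (fun z : Circle => (z : ℂ)) := by
  have := finrank_real_complex_fact'
  exact contMDiff_coe_sphere

theorem isOpen_arcNear (θ₀ : ℝ) : IsOpen (arcNear θ₀) :=
  Complex.isOpen_slitPlane.preimage
    (contMDiff_circle_coe.continuous.comp (continuous_id.mul continuous_const))

theorem exp_mem_arcNear {θ₀ θ : ℝ} (h : |θ - θ₀| < Real.pi) : Circle.exp θ ∈ arcNear θ₀ := by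
  rw [abs_lt] at h
  change ((Circle.exp θ * (Circle.exp θ₀)⁻¹ : Circle) : ℂ) ∈ Complex.slitPlane
  rw [Complex.mem_slitPlane_iff_arg, ← Circle.exp_neg, ← Circle.exp_add,
    ← sub_eq_add_neg, Circle.arg_exp h.1 h.2.le]
  exact ⟨h.2.ne, Circle.coe_ne_zero _⟩

theorem contMDiffOn_angleNear (θ₀ : ℝ) :
    ContMDiffOn (𝓡 1) 𝓘(ℝ, ℝ) ∞ (angleNear θ₀) (arcNear θ₀) := by
  intro z hz
  have h1 : ContMDiffAt (𝓡 1) 𝓘(ℝ, ℂ) ∞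
      (fun z : Circle => ((z * (Circle.exp θ₀)⁻¹ : Circle) : ℂ)) z := by
    have : LieGroup (𝓡 1) ∞ Circle := LieGroup.of_le (n := ω) le_top
    exact (contMDiff_circle_coe.comp (contMDiff_mul_right (I := 𝓡 1) (n := ∞)
      (a := (Circle.exp θ₀)⁻¹))).contMDiffAt
  have h2 : ContDiffAt ℝ ∞ (fun w : ℂ => θ₀ + Complex.arg w)
      ((z * (Circle.exp θ₀)⁻¹ : Circle) : ℂ) := by
    have h3 : ContDiffAt ℝ ∞ Complex.log ((z * (Circle.exp θ₀)⁻¹ : Circle) : ℂ) :=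
      (Complex.contDiffAt_log hz).restrict_scalars ℝ
    have h4 : ContDiffAt ℝ ∞ (fun w : ℂ => θ₀ + Complex.imCLM (Complex.log w))
      ((z * (Circle.exp θ₀)⁻¹ : Circle) : ℂ) :=
      contDiffAt_const.add (Complex.imCLM.contDiff.contDiffAt.comp _ h3)
    exact h4.congr_of_eventuallyEq (.of_forall fun w => by
      simp only [Complex.imCLM_apply, Complex.log_im])
  exact (h2.contMDiffAt.comp z h1).contMDiffWithinAt

/-- The covering of `S¹ × ℝ` by the plane. -/
noncomputable def annulusCover (x : ℝ × ℝ) : Circle × ℝ := (Circle.exp x.1, x.2)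

theorem contMDiff_annulusCover :
    ContMDiff 𝓘(ℝ, ℝ × ℝ) ((𝓡 1).prod 𝓘(ℝ, ℝ)) ∞ annulusCover :=
  (contMDiff_circleExp.comp contDiff_fst.contMDiff).prodMk contDiff_snd.contMDiff

theorem isOpenMap_annulusCover : IsOpenMap annulusCover :=
  isLocalHomeomorph_circleExp.isOpenMap.prodMap IsOpenMap.id

/-- The local inverse of `annulusCover` given by a branch of the angle. -/
noncomputable def annulusLift (θ₀ : ℝ) (x : Circle × ℝ) : ℝ × ℝ := (angleNear θ₀ x.1, x.2)

theorem annulusCover_annulusLift (θ₀ : ℝ) (x : Circle × ℝ) :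
    annulusCover (annulusLift θ₀ x) = x := by
  rw [annulusCover, annulusLift, exp_angleNear]

theorem contMDiffOn_annulusLift (θ₀ : ℝ) :
    ContMDiffOn ((𝓡 1).prod 𝓘(ℝ, ℝ)) 𝓘(ℝ, ℝ × ℝ) ∞ (annulusLift θ₀)
      (arcNear θ₀ ×ˢ univ) := by
  have h1 : ContMDiffOn ((𝓡 1).prod 𝓘(ℝ, ℝ)) 𝓘(ℝ, ℝ) ∞
      (fun x : Circle × ℝ => angleNear θ₀ x.1) (arcNear θ₀ ×ˢ univ) :=
    (contMDiffOn_angleNear θ₀).comp contMDiff_fst.contMDiffOn fun x hx => hx.1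
  exact h1.prodMk_space contMDiff_snd.contMDiffOn

theorem annulusCover_eq_iff {x y : ℝ × ℝ} :
    annulusCover x = annulusCover y ↔ ∃ m : ℤ, x = y + ((m * (2 * Real.pi) : ℝ), (0 : ℝ)) := by
  simp only [annulusCover, Circle.exp_eq_exp, Prod.ext_iff, Prod.fst_add,
    Prod.snd_add, add_zero]
  exact ⟨fun ⟨⟨m, h⟩, h'⟩ => ⟨m, h, h'⟩, fun ⟨m, h, h'⟩ => ⟨⟨m, h⟩, h'⟩⟩

/-- A function on the annulus is smooth if it is smooth as a periodic function on the plane. -/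
theorem contMDiffOn_of_comp_annulusCover {E' H' : Type*} [NormedAddCommGroup E']
    [NormedSpace ℝ E'] [TopologicalSpace H'] {J : ModelWithCorners ℝ E' H'} {N : Type*}
    [TopologicalSpace N] [ChartedSpace H' N] {G : Circle × ℝ → N} {U : Set (ℝ × ℝ)}
    (hU : IsOpen U)
    (hG : ContMDiffOn 𝓘(ℝ, ℝ × ℝ) J ∞ (G ∘ annulusCover) U) :
    ContMDiffOn ((𝓡 1).prod 𝓘(ℝ, ℝ)) J ∞ G (annulusCover '' U) := by
  rintro _ ⟨⟨θ, r⟩, hx, rfl⟩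
  have h0 : annulusLift θ (annulusCover (θ, r)) = (θ, r) := by
    simp [annulusLift, annulusCover, angleNear_exp, Real.pi_pos]
  have hmem : annulusCover (θ, r) ∈ arcNear θ ×ˢ (univ : Set ℝ) :=
    ⟨exp_mem_arcNear (by simp [Real.pi_pos]), mem_univ _⟩
  have h1 : ContMDiffAt ((𝓡 1).prod 𝓘(ℝ, ℝ)) 𝓘(ℝ, ℝ × ℝ) ∞ (annulusLift θ)
      (annulusCover (θ, r)) :=
    (contMDiffOn_annulusLift θ).contMDiffAt
      (((isOpen_arcNear θ).prod isOpen_univ).mem_nhds hmem)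
  have h2 : ContMDiffAt 𝓘(ℝ, ℝ × ℝ) J ∞ (G ∘ annulusCover)
      (annulusLift θ (annulusCover (θ, r))) := by
    rw [h0]
    exact hG.contMDiffAt (hU.mem_nhds hx)
  have h3 := h2.comp _ h1
  have h4 : (G ∘ annulusCover) ∘ annulusLift θ = G := by
    funext x
    simp [annulusCover_annulusLift]
  rw [h4] at h3
  exact h3.contMDiffWithinAt

theorem annulusCover_image_strip (s : Set ℝ) :
    annulusCover '' (univ ×ˢ s) = univ ×ˢ s := by
  ext x
  constructor
  · rintro ⟨y, hy, rfl⟩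
    exact ⟨mem_univ _, hy.2⟩
  · intro hx
    exact ⟨annulusLift 0 x, ⟨mem_univ _, hx.2⟩, annulusCover_annulusLift 0 x⟩

/-- A periodic family of increasing substitutions `r = B(θ, ρ)` defines a diffeomorphism between
open subsets of the annulus. The diffeomorphism `Λ` is taken in the direction of a chart: it maps
the coordinates `(θ, r)` to `(θ, ρ)`. -/
theorem exists_partialDiffeomorph_of_substitution {δ : ℝ} {B : ℝ × ℝ → ℝ}
    (hB : ContDiffOn ℝ ∞ B (univ ×ˢ Ioo (-δ) δ))
    (hper : ∀ θ, ∀ ρ ∈ Ioo (-δ) δ, B (θ + 2 * Real.pi, ρ) = B (θ, ρ))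
    (hpos : ∀ θ, ∀ ρ ∈ Ioo (-δ) δ, 0 < fderiv ℝ B (θ, ρ) (0, 1)) :
    ∃ Λ : PartialDiffeomorph ((𝓡 1).prod 𝓘(ℝ, ℝ)) ((𝓡 1).prod 𝓘(ℝ, ℝ))
      (Circle × ℝ) (Circle × ℝ) ∞, Λ.target = univ ×ˢ Ioo (-δ) δ ∧
      ∀ θ, ∀ ρ ∈ Ioo (-δ) δ, Λ.symm (annulusCover (θ, ρ)) = annulusCover (θ, B (θ, ρ)) := by
  set S : Set (ℝ × ℝ) := univ ×ˢ Ioo (-δ) δ with hS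
  have hSo : IsOpen S := isOpen_univ.prod isOpen_Ioo
  have hBat : ∀ x ∈ S, ContDiffAt ℝ ∞ B x := fun x hx => hB.contDiffAt (hSo.mem_nhds hx)
  set F : ℝ × ℝ → ℝ × ℝ := fun x => (x.1, B x) with hF
  have hFat : ∀ x ∈ S, ContDiffAt ℝ ∞ F x := fun x hx => contDiffAt_fst.prodMk (hBat x hx)
  have hmono : ∀ θ, StrictMonoOn (fun ρ => B (θ, ρ)) (Ioo (-δ) δ) := by
    intro θ
    have hd : ∀ ρ ∈ Ioo (-δ) δ,
        HasDerivAt (fun ρ => B (θ, ρ)) (fderiv ℝ B (θ, ρ) (0, 1)) ρ := fun ρ hρ =>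
      ((hBat (θ, ρ) ⟨mem_univ _, hρ⟩).differentiableAt (by simp)).hasFDerivAt.comp_hasDerivAt ρ
        ((hasDerivAt_const ρ θ).prodMk (hasDerivAt_id ρ))
    refine strictMonoOn_of_deriv_pos (convex_Ioo _ _)
      (fun ρ hρ => (hd ρ hρ).continuousAt.continuousWithinAt) fun ρ hρ => ?_
    rw [interior_Ioo] at hρ
    rw [(hd ρ hρ).deriv]
    exact hpos θ ρ hρ
  have hinj : InjOn F S := by
    rintro ⟨θ, ρ⟩ hx ⟨θ', ρ'⟩ hx' h
    obtain ⟨h1, h2⟩ := Prod.mk.inj h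
    dsimp only at h1 h2
    subst h1
    exact congrArg _ ((hmono θ).injOn hx.2 hx'.2 h2)
  -- the derivative of `F` is triangular with nonzero diagonal
  have hequiv : ∀ x ∈ S, ∃ e : (ℝ × ℝ) ≃L[ℝ] ℝ × ℝ, HasFDerivAt F (e : ℝ × ℝ →L[ℝ] ℝ × ℝ) x := by
    intro x hx
    have hx0 : fderiv ℝ B x (0, 1) ≠ 0 := (hpos x.1 x.2 hx.2).ne'
    have hd : HasFDerivAt F ((ContinuousLinearMap.fst ℝ ℝ ℝ).prod (fderiv ℝ B x)) x :=
      hasFDerivAt_fst.prodMk ((hBat x hx).differentiableAt (by simp)).hasFDerivAt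
    have hker : ((ContinuousLinearMap.fst ℝ ℝ ℝ).prod (fderiv ℝ B x)).ker = ⊥ := by
      rw [LinearMap.ker_eq_bot']
      rintro ⟨v, w⟩ h
      obtain ⟨h1, h2⟩ := Prod.mk.inj h
      have h1' : v = 0 := h1
      subst h1'
      have h3 : ((0 : ℝ), w) = w • ((0 : ℝ), (1 : ℝ)) := by simp
      have h4 : fderiv ℝ B x (0, w) = 0 := h2
      rw [h3, map_smul, smul_eq_mul] at h4
      rw [(mul_eq_zero.1 h4).resolve_right hx0]
      rfl
    have hinj' : Function.Injective
        ((ContinuousLinearMap.fst ℝ ℝ ℝ).prod (fderiv ℝ B x)).toLinearMap :=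
      LinearMap.ker_eq_bot.1 hker
    refine ⟨(LinearEquiv.ofInjectiveEndo _ hinj').toContinuousLinearEquiv, ?_⟩
    convert hd using 1
    exact ContinuousLinearMap.ext fun v => rfl
  have hFo : ∀ W ⊆ S, IsOpen W → IsOpen (F '' W) := by
    intro W hW hWo
    rw [isOpen_iff_mem_nhds]
    rintro _ ⟨x, hx, rfl⟩
    obtain ⟨e, he⟩ := hequiv x (hW hx)
    have h1 := ((hFat x (hW hx)).hasStrictFDerivAt' he (by simp)).map_nhds_eq_of_equiv
    rw [← h1]
    exact image_mem_map (hWo.mem_nhds hx)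
  set C : ℝ × ℝ → ℝ × ℝ := Function.invFunOn F S with hC
  have hCF : ∀ x ∈ S, C (F x) = x := fun x hx => hinj.leftInvOn_invFunOn hx
  have hCs : ContDiffOn ℝ ∞ C (F '' S) := by
    rintro _ ⟨x, hx, rfl⟩
    obtain ⟨e, he⟩ := hequiv x hx
    have h1 := (hFat x hx).to_localInverse he (by simp)
    refine (h1.congr_of_eventuallyEq ?_).contDiffWithinAt
    have hst := (hFat x hx).hasStrictFDerivAt' he (by simp)
    have h2 := hst.eventually_right_inverse
    have h3 : ∀ᶠ y in 𝓝 (F x), (hFat x hx).localInverse he (by simp) y ∈ S := by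
      refine h1.continuousAt.eventually_mem (hSo.mem_nhds ?_)
      rw [ContDiffAt.localInverse_apply_image]
      exact hx
    filter_upwards [h2, h3] with y hy1 hy2
    have h4 := hCF _ hy2
    rw [← h4]
    exact congrArg C hy1.symm
  have hBint : ∀ (m : ℤ) x, x ∈ S → B (x + ((m * (2 * Real.pi) : ℝ), (0 : ℝ))) = B x := by
    rintro m ⟨θ, ρ⟩ hx
    have h1 : Function.Periodic (fun θ => B (θ, ρ)) (2 * Real.pi) := fun θ => hper θ ρ hx.2
    simpa using h1.int_mul m θ
  -- descent of `F` and of its inverse to the annulus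
  let G : Circle × ℝ → Circle × ℝ := fun x => annulusCover (F (annulusLift 0 x))
  have hGF : ∀ x ∈ S, G (annulusCover x) = annulusCover (F x) := by
    intro x hx
    obtain ⟨m, hm⟩ := annulusCover_eq_iff.1 (annulusCover_annulusLift 0 (annulusCover x))
    change annulusCover (F (annulusLift 0 (annulusCover x))) = _
    rw [hm, annulusCover_eq_iff]
    refine ⟨m, ?_⟩
    simp only [hF]
    rw [hBint m x hx]
    simp
  have hGinj : InjOn G (univ ×ˢ Ioo (-δ) δ) := by
    rw [← annulusCover_image_strip]
    rintro _ ⟨x, hx, rfl⟩ _ ⟨y, hy, rfl⟩ h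
    rw [hGF x hx, hGF y hy, annulusCover_eq_iff] at h
    obtain ⟨m, hm⟩ := h
    rw [annulusCover_eq_iff]
    have hy' : y + ((m * (2 * Real.pi) : ℝ), (0 : ℝ)) ∈ S := ⟨mem_univ _, by simpa using hy.2⟩
    refine ⟨m, hinj hx hy' ?_⟩
    rw [hm]
    simp only [hF]
    rw [hBint m y hy]
    simp
  have hGim : G '' (univ ×ˢ Ioo (-δ) δ) = annulusCover '' (F '' S) := by
    rw [← annulusCover_image_strip, image_image, image_image]
    exact image_congr fun x hx => hGF x hx
  have hFSo : IsOpen (F '' S) := hFo S subset_rfl hSo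
  have hGs : ContMDiffOn ((𝓡 1).prod 𝓘(ℝ, ℝ)) ((𝓡 1).prod 𝓘(ℝ, ℝ)) ∞ G
      (univ ×ˢ Ioo (-δ) δ) := by
    rw [← annulusCover_image_strip]
    refine contMDiffOn_of_comp_annulusCover hSo ?_
    refine (contMDiff_annulusCover.comp_contMDiffOn (ContDiffOn.contMDiffOn
      fun x hx => (hFat x hx).contDiffWithinAt)).congr fun x hx => hGF x hx
  have hGinvs : ContMDiffOn ((𝓡 1).prod 𝓘(ℝ, ℝ)) ((𝓡 1).prod 𝓘(ℝ, ℝ)) ∞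
      (Function.invFunOn G (univ ×ˢ Ioo (-δ) δ)) (annulusCover '' (F '' S)) := by
    refine contMDiffOn_of_comp_annulusCover hFSo ?_
    refine (contMDiff_annulusCover.comp_contMDiffOn hCs.contMDiffOn).congr ?_
    rintro _ ⟨x, hx, rfl⟩
    rw [Function.comp_apply, Function.comp_apply, hCF x hx, ← hGF x hx]
    exact hGinj.leftInvOn_invFunOn ⟨mem_univ _, hx.2⟩
  let Λ₀ : PartialDiffeomorph ((𝓡 1).prod 𝓘(ℝ, ℝ)) ((𝓡 1).prod 𝓘(ℝ, ℝ))
      (Circle × ℝ) (Circle × ℝ) ∞ :=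
    { toPartialEquiv := BijOn.toPartialEquiv G (univ ×ˢ Ioo (-δ) δ)
        (annulusCover '' (F '' S)) (hGim ▸ hGinj.bijOn_image)
      open_source := isOpen_univ.prod isOpen_Ioo
      open_target := isOpenMap_annulusCover _ hFSo
      contMDiffOn_toFun := hGs
      contMDiffOn_invFun := hGinvs }
  exact ⟨Λ₀.symm, rfl, fun θ ρ hρ => hGF (θ, ρ) ⟨mem_univ _, hρ⟩⟩

end Annulus

/-! ### The foliation in planar coordinates -/

section Planar

open Filter Topology

variable {E H : Type*} [NormedAddCommGroup E] [NormedSpace ℝ E]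
  [TopologicalSpace H] {I : ModelWithCorners ℝ E H}
  {M : Type*} [TopologicalSpace M] [ChartedSpace H M]
  {ψ : PartialDiffeomorph I ((𝓡 1).prod 𝓘(ℝ, ℝ)) M (Circle × ℝ) ∞} {ε : ℝ}

/-- The covering of the annulus in `M` by a strip in the plane. -/
noncomputable def annularParam
    (ψ : PartialDiffeomorph I ((𝓡 1).prod 𝓘(ℝ, ℝ)) M (Circle × ℝ) ∞) (x : ℝ × ℝ) : M :=
  ψ.symm (annulusCover x)

/-- The local inverse of `annularParam` given by a branch of the angle. -/
noncomputable def annularLift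
    (ψ : PartialDiffeomorph I ((𝓡 1).prod 𝓘(ℝ, ℝ)) M (Circle × ℝ) ∞) (θ₀ : ℝ) (y : M) : ℝ × ℝ :=
  annulusLift θ₀ (ψ y)

theorem isOpen_strip (ε : ℝ) : IsOpen ((univ : Set ℝ) ×ˢ Ioo (-ε) ε) := isOpen_univ.prod isOpen_Ioo

theorem annulusCover_mem_target (hψ : ψ.target = univ ×ˢ Ioo (-ε) ε) {x : ℝ × ℝ}
    (hx : x.2 ∈ Ioo (-ε) ε) : annulusCover x ∈ ψ.target := by
  rw [hψ]
  exact ⟨mem_univ _, hx⟩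

theorem annularParam_mem_source (hψ : ψ.target = univ ×ˢ Ioo (-ε) ε) {x : ℝ × ℝ}
    (hx : x.2 ∈ Ioo (-ε) ε) : annularParam ψ x ∈ ψ.source :=
  ψ.map_target (annulusCover_mem_target hψ hx)

theorem apply_annularParam (hψ : ψ.target = univ ×ˢ Ioo (-ε) ε) {x : ℝ × ℝ}
    (hx : x.2 ∈ Ioo (-ε) ε) : ψ (annularParam ψ x) = annulusCover x :=
  ψ.right_inv (annulusCover_mem_target hψ hx)

theorem annularParam_annularLift (θ₀ : ℝ) {y : M} (hy : y ∈ ψ.source) :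
    annularParam ψ (annularLift ψ θ₀ y) = y := by
  rw [annularParam, annularLift, annulusCover_annulusLift]
  exact ψ.left_inv hy

theorem annularLift_annularParam (hψ : ψ.target = univ ×ˢ Ioo (-ε) ε) {θ₀ : ℝ} {x : ℝ × ℝ}
    (hx : x.2 ∈ Ioo (-ε) ε) (hθ : |x.1 - θ₀| < Real.pi) :
    annularLift ψ θ₀ (annularParam ψ x) = x := by
  rw [annularLift, apply_annularParam hψ hx, annulusLift, annulusCover, angleNear_exp hθ]

theorem annularLift_snd (θ₀ : ℝ) (y : M) : (annularLift ψ θ₀ y).2 = (ψ y).2 := rfl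

theorem apply_snd_mem (hψ : ψ.target = univ ×ˢ Ioo (-ε) ε) {y : M} (hy : y ∈ ψ.source) :
    (ψ y).2 ∈ Ioo (-ε) ε := by
  have h : ψ y ∈ ψ.target := ψ.map_source hy
  rw [hψ] at h
  exact h.2

theorem annularParam_periodic : Function.Periodic (annularParam ψ) (2 * Real.pi, 0) := by
  intro x
  exact congrArg ψ.symm (annulusCover_eq_iff.2 ⟨1, by simp⟩)

theorem contMDiffOn_annularParam (hψ : ψ.target = univ ×ˢ Ioo (-ε) ε) :
    ContMDiffOn 𝓘(ℝ, ℝ × ℝ) I ∞ (annularParam ψ) (univ ×ˢ Ioo (-ε) ε) :=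
  ψ.symm.contMDiffOn.comp contMDiff_annulusCover.contMDiffOn
    fun _ hx => annulusCover_mem_target hψ hx.2

theorem mdifferentiableAt_annularParam (hψ : ψ.target = univ ×ˢ Ioo (-ε) ε) {x : ℝ × ℝ}
    (hx : x.2 ∈ Ioo (-ε) ε) : MDifferentiableAt 𝓘(ℝ, ℝ × ℝ) I (annularParam ψ) x :=
  ((contMDiffOn_annularParam hψ).contMDiffAt
    ((isOpen_strip ε).mem_nhds ⟨mem_univ _, hx⟩)).mdifferentiableAt (by simp)

/-- The part of the annulus away from the antipodal ray of `exp (i θ₀)`, on which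
`annularLift ψ θ₀` is smooth. -/
def annularArc (ψ : PartialDiffeomorph I ((𝓡 1).prod 𝓘(ℝ, ℝ)) M (Circle × ℝ) ∞) (θ₀ : ℝ) : Set M :=
  ψ.source ∩ ψ ⁻¹' (arcNear θ₀ ×ˢ univ)

theorem isOpen_annularArc (θ₀ : ℝ) : IsOpen (annularArc ψ θ₀) :=
  ψ.contMDiffOn.continuousOn.isOpen_inter_preimage ψ.open_source
    ((isOpen_arcNear θ₀).prod isOpen_univ)

theorem contMDiffOn_annularLift (θ₀ : ℝ) :
    ContMDiffOn I 𝓘(ℝ, ℝ × ℝ) ∞ (annularLift ψ θ₀) (annularArc ψ θ₀) :=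
  (contMDiffOn_annulusLift θ₀).comp (ψ.contMDiffOn.mono inter_subset_left) fun _ hy => hy.2

theorem annularParam_mem_annularArc (hψ : ψ.target = univ ×ˢ Ioo (-ε) ε) {θ₀ : ℝ} {x : ℝ × ℝ}
    (hx : x.2 ∈ Ioo (-ε) ε) (hθ : |x.1 - θ₀| < Real.pi) :
    annularParam ψ x ∈ annularArc ψ θ₀ := by
  refine ⟨annularParam_mem_source hψ hx, ?_⟩
  rw [mem_preimage, apply_annularParam hψ hx]
  exact ⟨exp_mem_arcNear hθ, mem_univ _⟩

theorem contMDiffAt_annularLift (hψ : ψ.target = univ ×ˢ Ioo (-ε) ε) {θ₀ : ℝ} {x : ℝ × ℝ}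
    (hx : x.2 ∈ Ioo (-ε) ε) (hθ : |x.1 - θ₀| < Real.pi) :
    ContMDiffAt I 𝓘(ℝ, ℝ × ℝ) ∞ (annularLift ψ θ₀) (annularParam ψ x) :=
  (contMDiffOn_annularLift θ₀).contMDiffAt
    ((isOpen_annularArc θ₀).mem_nhds (annularParam_mem_annularArc hψ hx hθ))

/-- The derivative of `annularParam`, read in the model spaces. -/
noncomputable def paramDeriv (ψ : PartialDiffeomorph I ((𝓡 1).prod 𝓘(ℝ, ℝ)) M (Circle × ℝ) ∞)
    (x : ℝ × ℝ) : ℝ × ℝ →L[ℝ] E :=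
  mfderiv 𝓘(ℝ, ℝ × ℝ) I (annularParam ψ) x

/-- The derivative of `annularLift`, read in the model spaces. -/
noncomputable def liftDeriv (ψ : PartialDiffeomorph I ((𝓡 1).prod 𝓘(ℝ, ℝ)) M (Circle × ℝ) ∞)
    (θ₀ : ℝ) (y : M) : E →L[ℝ] ℝ × ℝ :=
  mfderiv I 𝓘(ℝ, ℝ × ℝ) (annularLift ψ θ₀) y

theorem liftDeriv_paramDeriv (hψ : ψ.target = univ ×ˢ Ioo (-ε) ε) {θ₀ : ℝ} {x : ℝ × ℝ}
    (hx : x.2 ∈ Ioo (-ε) ε) (hθ : |x.1 - θ₀| < Real.pi) (w : ℝ × ℝ) :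
    liftDeriv ψ θ₀ (annularParam ψ x) (paramDeriv ψ x w) = w := by
  have h1 := mfderiv_comp_apply x
    ((contMDiffAt_annularLift hψ hx hθ).mdifferentiableAt (by simp))
    (mdifferentiableAt_annularParam hψ hx) w
  have h2 : annularLift ψ θ₀ ∘ annularParam ψ =ᶠ[𝓝 x] id := by
    have h3 : ∀ᶠ x' : ℝ × ℝ in 𝓝 x, |x'.1 - θ₀| < Real.pi :=
      (by fun_prop : Continuous fun x' : ℝ × ℝ => |x'.1 - θ₀|).continuousAt.eventually_lt
        continuousAt_const hθ
    filter_upwards [h3, (isOpen_strip ε).mem_nhds ⟨mem_univ _, hx⟩] with x' hx' hx''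
    exact annularLift_annularParam hψ hx''.2 hx'
  have h5 : HasMFDerivAt 𝓘(ℝ, ℝ × ℝ) 𝓘(ℝ, ℝ × ℝ) (annularLift ψ θ₀ ∘ annularParam ψ) x
      (ContinuousLinearMap.id ℝ (TangentSpace 𝓘(ℝ, ℝ × ℝ) x)) :=
    (hasMFDerivAt_id x).congr_of_eventuallyEq h2
  rw [h5.mfderiv] at h1
  exact h1.symm

theorem paramDeriv_liftDeriv (hψ : ψ.target = univ ×ˢ Ioo (-ε) ε) {θ₀ : ℝ} {x : ℝ × ℝ}
    (hx : x.2 ∈ Ioo (-ε) ε) (hθ : |x.1 - θ₀| < Real.pi) (v : E) :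
    paramDeriv ψ x (liftDeriv ψ θ₀ (annularParam ψ x) v) = v := by
  have h1 := mfderiv_comp_apply_of_eq (annularParam ψ x)
    (mdifferentiableAt_annularParam hψ hx)
    ((contMDiffAt_annularLift hψ hx hθ).mdifferentiableAt (by simp))
    (annularLift_annularParam hψ hx hθ) v
  have h2 : annularParam ψ ∘ annularLift ψ θ₀ =ᶠ[𝓝 (annularParam ψ x)] id := by
    filter_upwards [ψ.open_source.mem_nhds (annularParam_mem_source hψ hx)] with y hy
    exact annularParam_annularLift θ₀ hy
  have h5 : HasMFDerivAt I I (annularParam ψ ∘ annularLift ψ θ₀) (annularParam ψ x)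
      (ContinuousLinearMap.id ℝ (TangentSpace I (annularParam ψ x))) :=
    (hasMFDerivAt_id _).congr_of_eventuallyEq h2
  rw [h5.mfderiv] at h1
  exact h1.symm

theorem paramDeriv_periodic (hψ : ψ.target = univ ×ˢ Ioo (-ε) ε) {x : ℝ × ℝ}
    (hx : x.2 ∈ Ioo (-ε) ε) : paramDeriv ψ (x + (2 * Real.pi, 0)) = paramDeriv ψ x := by
  have hd := mdifferentiableAt_annularParam hψ (x := x + (2 * Real.pi, 0)) (by simpa using hx)
  have h4 : HasMFDerivAt 𝓘(ℝ, ℝ × ℝ) 𝓘(ℝ, ℝ × ℝ) (fun x : ℝ × ℝ => x + (2 * Real.pi, 0)) x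
      (ContinuousLinearMap.id ℝ (ℝ × ℝ)) :=
    ((hasFDerivAt_id x).add_const _).hasMFDerivAt
  have h5 := hd.hasMFDerivAt.comp x h4
  have h6 : annularParam ψ ∘ (fun x : ℝ × ℝ => x + (2 * Real.pi, 0)) = annularParam ψ :=
    funext annularParam_periodic
  rw [h6] at h5
  exact h5.mfderiv.symm

variable [IsManifold I ∞ M]

/-- The line field of a foliation, read in the model space. -/
def LineFoliation.direction (L : LineFoliation I M) (y : M) : Submodule ℝ E := L.line y

/-- The line field of the foliation, pulled back to the strip. -/
noncomputable def planarLine (L : LineFoliation I M)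
    (ψ : PartialDiffeomorph I ((𝓡 1).prod 𝓘(ℝ, ℝ)) M (Circle × ℝ) ∞) (x : ℝ × ℝ) :
    Submodule ℝ (ℝ × ℝ) :=
  (L.direction (annularParam ψ x)).comap (paramDeriv ψ x).toLinearMap

theorem mem_planarLine_iff {L : LineFoliation I M} {x w : ℝ × ℝ} :
    w ∈ planarLine L ψ x ↔ paramDeriv ψ x w ∈ L.direction (annularParam ψ x) := Iff.rfl

theorem liftDeriv_mem_planarLine_iff (L : LineFoliation I M)
    (hψ : ψ.target = univ ×ˢ Ioo (-ε) ε) {θ₀ : ℝ} {x : ℝ × ℝ}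
    (hx : x.2 ∈ Ioo (-ε) ε) (hθ : |x.1 - θ₀| < Real.pi) (v : E) :
    liftDeriv ψ θ₀ (annularParam ψ x) v ∈ planarLine L ψ x ↔
      v ∈ L.direction (annularParam ψ x) := by
  rw [mem_planarLine_iff, paramDeriv_liftDeriv hψ hx hθ]

theorem planarLine_periodic (L : LineFoliation I M) (hψ : ψ.target = univ ×ˢ Ioo (-ε) ε)
    {x : ℝ × ℝ} (hx : x.2 ∈ Ioo (-ε) ε) :
    planarLine L ψ (x + (2 * Real.pi, 0)) = planarLine L ψ x := by
  rw [planarLine, planarLine, paramDeriv_periodic hψ hx, annularParam_periodic x]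

/-- The derivative of a vector valued function along a smooth vector field is smooth. -/
theorem contMDiffOn_mfderiv_apply {V : Type*} [NormedAddCommGroup V] [NormedSpace ℝ V]
    {g : M → V} {W : Set M} (hW : IsOpen W) (hg : ContMDiffOn I 𝓘(ℝ, V) ∞ g W)
    {X : ∀ y : M, TangentSpace I y}
    (hX : ContMDiffOn I I.tangent ∞ (fun y => (⟨y, X y⟩ : TangentBundle I M)) W) :
    ContMDiffOn I 𝓘(ℝ, V) ∞ (fun y => (mfderiv I 𝓘(ℝ, V) g y : E → V) (X y)) W := by
  have h1 := hg.contMDiffOn_tangentMapWithin (m := ∞) (by simp) hW.uniqueMDiffOn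
  have h2 := h1.comp hX fun y hy => hy
  have h3 := (contMDiff_snd_tangentBundle_modelSpace (n := ∞) V 𝓘(ℝ, V)).comp_contMDiffOn h2
  refine h3.congr fun y hy => ?_
  change (mfderiv I 𝓘(ℝ, V) g y : E → V) (X y) = (mfderivWithin I 𝓘(ℝ, V) g W y : E → V) (X y)
  rw [mfderivWithin_of_isOpen hW hy]

/-- Near each point of the strip the planar line field is spanned by a smooth vector field without
zeros. -/
theorem exists_local_generator (L : LineFoliation I M) (hψ : ψ.target = univ ×ˢ Ioo (-ε) ε)
    {x₀ : ℝ × ℝ} (hx₀ : x₀.2 ∈ Ioo (-ε) ε) :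
    ∃ Z : ℝ × ℝ → ℝ × ℝ, ∃ O : Set (ℝ × ℝ), IsOpen O ∧ x₀ ∈ O ∧ ContDiffOn ℝ ∞ Z O ∧
      ∀ x ∈ O, Z x ≠ 0 ∧ planarLine L ψ x = Submodule.span ℝ {Z x} := by
  obtain ⟨W, hWo, hW, X, hX, hXL⟩ := L.locally_spanned (annularParam ψ x₀)
  obtain ⟨Y, hY⟩ : ∃ Y : M → E, ∀ y, Y y = X y := ⟨X, fun _ => rfl⟩
  have hW' : IsOpen (W ∩ annularArc ψ x₀.1) := hWo.inter (isOpen_annularArc _)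
  set S : Set (ℝ × ℝ) := univ ×ˢ Ioo (-ε) ε with hS
  set O : Set (ℝ × ℝ) := (S ∩ annularParam ψ ⁻¹' (W ∩ annularArc ψ x₀.1)) ∩
    {x | |x.1 - x₀.1| < Real.pi} with hO
  have h1 : ContMDiffOn I 𝓘(ℝ, ℝ × ℝ) ∞ (fun y => liftDeriv ψ x₀.1 y (Y y))
      (W ∩ annularArc ψ x₀.1) := by
    simp only [hY]
    exact contMDiffOn_mfderiv_apply hW' ((contMDiffOn_annularLift x₀.1).mono inter_subset_right)
      (hX.mono inter_subset_left)
  refine ⟨fun x => liftDeriv ψ x₀.1 (annularParam ψ x) (Y (annularParam ψ x)), O, ?_, ?_, ?_, ?_⟩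
  · exact ((contMDiffOn_annularParam hψ).continuousOn.isOpen_inter_preimage (isOpen_strip ε)
      hW').inter (isOpen_lt (by fun_prop) continuous_const)
  · have hπ : |x₀.1 - x₀.1| < Real.pi := by simp [Real.pi_pos]
    exact ⟨⟨⟨mem_univ _, hx₀⟩, hW, annularParam_mem_annularArc hψ hx₀ hπ⟩, hπ⟩
  · rw [← contMDiffOn_iff_contDiffOn]
    exact h1.comp ((contMDiffOn_annularParam hψ).mono fun x hx => hx.1.1) fun x hx => hx.1.2
  · rintro x ⟨⟨hxS, hxW⟩, hxπ⟩
    obtain ⟨hX0, hXl⟩ := hXL _ hxW.1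
    have hXl' : ∀ v : E, v ∈ L.direction (annularParam ψ x) ↔
        ∃ c : ℝ, c • Y (annularParam ψ x) = v := by
      intro v
      change v ∈ L.line (annularParam ψ x) ↔ _
      rw [hXl, hY]
      exact Submodule.mem_span_singleton (M := TangentSpace I (annularParam ψ x))
    have hinv := paramDeriv_liftDeriv hψ hxS.2 hxπ (Y (annularParam ψ x))
    refine ⟨fun h0 => hX0 ?_, ?_⟩
    · dsimp only at h0
      rw [h0, map_zero] at hinv
      exact (hY _).symm.trans hinv.symm
    · ext w
      rw [mem_planarLine_iff, hXl', Submodule.mem_span_singleton]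
      constructor
      · rintro ⟨c, hc⟩
        refine ⟨c, ?_⟩
        rw [← map_smul, hc, liftDeriv_paramDeriv hψ hxS.2 hxπ]
      · rintro ⟨c, rfl⟩
        refine ⟨c, ?_⟩
        rw [map_smul, hinv]

/-- The velocity of a path in `M`, read in the model space. -/
noncomputable def pathVelocity (I : ModelWithCorners ℝ E H) (γ : ℝ → M) (s : ℝ) : ℝ →L[ℝ] E :=
  mfderiv 𝓘(ℝ, ℝ) I γ s

/-- A path tangent to the foliation is tangent to the planar line field after lifting. -/
theorem exists_hasDerivAt_annularLift_comp (L : LineFoliation I M)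
    (hψ : ψ.target = univ ×ˢ Ioo (-ε) ε) {θ₀ : ℝ} {γ : ℝ → M} {s : ℝ}
    (hγ : MDifferentiableAt 𝓘(ℝ, ℝ) I γ s) (hs : γ s ∈ annularArc ψ θ₀)
    (hθ : |(annularLift ψ θ₀ (γ s)).1 - θ₀| < Real.pi) :
    ∃ w : ℝ × ℝ, HasDerivAt (fun s => annularLift ψ θ₀ (γ s)) w s ∧
      (w ∈ planarLine L ψ (annularLift ψ θ₀ (γ s)) ↔
        mfderiv 𝓘(ℝ, ℝ) I γ s (1 : ℝ) ∈ L.line (γ s)) := by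
  have h1 : MDifferentiableAt I 𝓘(ℝ, ℝ × ℝ) (annularLift ψ θ₀) (γ s) :=
    ((contMDiffOn_annularLift θ₀).contMDiffAt
      ((isOpen_annularArc θ₀).mem_nhds hs)).mdifferentiableAt (by simp)
  have h2 : HasFDerivAt (fun s => annularLift ψ θ₀ (γ s))
      ((liftDeriv ψ θ₀ (γ s)).comp (pathVelocity I γ s)) s :=
    (h1.hasMFDerivAt.comp s hγ.hasMFDerivAt).hasFDerivAt
  refine ⟨_, h2.hasDerivAt, ?_⟩
  have h3 : annularParam ψ (annularLift ψ θ₀ (γ s)) = γ s := annularParam_annularLift θ₀ hs.1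
  have h4 := liftDeriv_mem_planarLine_iff L hψ
    (x := annularLift ψ θ₀ (γ s)) (apply_snd_mem hψ hs.1) hθ (pathVelocity I γ s 1)
  rw [h3] at h4
  exact h4

end Planar

/-! ### The slope of the foliation near the closed leaf -/

section Slope

open Filter Topology

variable {E H : Type*} [NormedAddCommGroup E] [NormedSpace ℝ E]
  [TopologicalSpace H] {I : ModelWithCorners ℝ E H}
  {M : Type*} [TopologicalSpace M] [ChartedSpace H M]
  {ψ : PartialDiffeomorph I ((𝓡 1).prod 𝓘(ℝ, ℝ)) M (Circle × ℝ) ∞} {ε : ℝ} {F : Set M}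

theorem IsAnnularChart.mem_core_iff (hψ : IsAnnularChart F ε ψ) {y : M} :
    y ∈ F ↔ y ∈ ψ.source ∧ (ψ y).2 = 0 := by
  have h : y ∈ F ↔ y ∈ ψ.source ∩ ψ ⁻¹' (univ ×ˢ {0}) := by rw [hψ.preimage_core]
  rw [h]
  exact and_congr_right fun _ => ⟨fun h => h.2, fun h => ⟨mem_univ _, h⟩⟩

theorem IsAnnularChart.annularParam_mem_core (hψ : IsAnnularChart F ε ψ) (hε : 0 < ε) (θ : ℝ) :
    annularParam ψ (θ, 0) ∈ F := by
  have h0 : ((θ, 0) : ℝ × ℝ).2 ∈ Ioo (-ε) ε := ⟨neg_lt_zero.2 hε, hε⟩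
  rw [hψ.mem_core_iff]
  refine ⟨annularParam_mem_source hψ.target_eq h0, ?_⟩
  rw [apply_annularParam hψ.target_eq h0]
  rfl

variable [IsManifold I ∞ M]

/-- The core of the annulus is tangent to the line field. A parametrization of the core by a leaf
path may have zero velocity, but at a point where the line field were not horizontal it would be
locally constant, contrary to injectivity. -/
theorem horizontal_mem_planarLine (L : LineFoliation I M) (hψ : IsAnnularChart F ε ψ) (hε : 0 < ε)
    {γ : ℝ → M} (hγ : L.IsLeafPath γ) (hinj : InjOn γ (Ico 0 1)) (him : γ '' Ico 0 1 = F) (θ : ℝ) :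
    ((1, 0) : ℝ × ℝ) ∈ planarLine L ψ (θ, 0) := by
  have h0 : ((θ, 0) : ℝ × ℝ).2 ∈ Ioo (-ε) ε := ⟨neg_lt_zero.2 hε, hε⟩
  have hπ : |((θ, 0) : ℝ × ℝ).1 - θ| < Real.pi := by simp [Real.pi_pos]
  obtain ⟨s₀, hs₀, hγs₀⟩ : annularParam ψ (θ, 0) ∈ γ '' Ico 0 1 := by
    rw [him]
    exact hψ.annularParam_mem_core hε θ
  obtain ⟨Z, O, hO, hθO, hZ, hZL⟩ := exists_local_generator L hψ.target_eq h0
  by_contra hnot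
  have hZ2 : (Z (θ, 0)).2 ≠ 0 := by
    intro hz
    apply hnot
    obtain ⟨hz0, hzl⟩ := hZL _ hθO
    rw [hzl, Submodule.mem_span_singleton]
    have hz1 : (Z (θ, 0)).1 ≠ 0 := fun h => hz0 (Prod.ext h hz)
    refine ⟨(Z (θ, 0)).1⁻¹, Prod.ext ?_ ?_⟩
    · simp [hz1]
    · simp [hz]
  set ζ : ℝ → ℝ × ℝ := fun s => annularLift ψ θ (γ s) with hζ
  have hζ0 : ζ s₀ = (θ, 0) := by
    simp only [hζ]
    rw [hγs₀, annularLift_annularParam hψ.target_eq h0 hπ]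
  have hζc : ContinuousAt ζ s₀ := by
    have h1 : ContinuousAt (annularLift ψ θ) (γ s₀) := by
      rw [hγs₀]
      exact (contMDiffAt_annularLift hψ.target_eq h0 hπ).continuousAt
    exact h1.comp hγ.smooth.continuous.continuousAt
  have hev : ∀ᶠ s in 𝓝 s₀, γ s ∈ annularArc ψ θ ∧ |(ζ s).1 - θ| < Real.pi ∧ ζ s ∈ O ∧
      (Z (ζ s)).2 ≠ 0 := by
    have h1 : ∀ᶠ s in 𝓝 s₀, γ s ∈ annularArc ψ θ :=
      hγ.smooth.continuous.continuousAt.eventually_mem ((isOpen_annularArc θ).mem_nhds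
        (by rw [hγs₀]; exact annularParam_mem_annularArc hψ.target_eq h0 hπ))
    have h2 : ∀ᶠ x : ℝ × ℝ in 𝓝 (θ, 0), |x.1 - θ| < Real.pi :=
      (by fun_prop : Continuous fun x : ℝ × ℝ => |x.1 - θ|).continuousAt.eventually_lt
        continuousAt_const hπ
    have h3 : ∀ᶠ x : ℝ × ℝ in 𝓝 (θ, 0), (Z x).2 ≠ 0 :=
      (hZ.continuousOn.continuousAt (hO.mem_nhds hθO)).snd.eventually_ne hZ2
    rw [← hζ0] at h2 h3
    filter_upwards [h1, hζc.eventually h2, hζc.eventually h3,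
      hζc.eventually_mem (hO.mem_nhds (by rw [hζ0]; exact hθO))] with s a b c d
    exact ⟨a, b, d, c⟩
  obtain ⟨η, hη, hball⟩ := Metric.eventually_nhds_iff_ball.1 hev
  rw [Real.ball_eq_Ioo] at hball
  -- Only times `s > s₀` with `s < 1` are used, where `γ` is known to run injectively in the core.
  obtain ⟨b, hb, hbη, hb1⟩ : ∃ b, s₀ < b ∧ b ≤ s₀ + η ∧ b ≤ 1 :=
    ⟨min (s₀ + η) 1, lt_min (by linarith) hs₀.2, min_le_left _ _, min_le_right _ _⟩
  have hsub : ∀ s ∈ Ioo s₀ b, s ∈ Ioo (s₀ - η) (s₀ + η) := fun s hs =>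
    ⟨by linarith [hs.1], by linarith [hs.2]⟩
  have hsub1 : ∀ s ∈ Ioo s₀ b, s ∈ Ico (0 : ℝ) 1 := fun s hs =>
    ⟨by linarith [hs.1, hs₀.1], by linarith [hs.2]⟩
  have hder : ∀ s ∈ Ioo s₀ b, HasDerivAt ζ 0 s := by
    intro s hs
    obtain ⟨h1, h2, h3, h4⟩ := hball s (hsub s hs)
    obtain ⟨w, hw, hwL⟩ := exists_hasDerivAt_annularLift_comp L hψ.target_eq
      (hγ.smooth.mdifferentiable (by simp) s) h1 h2
    have h5 := hwL.2 (hγ.tangent s)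
    rw [(hZL _ h3).2, Submodule.mem_span_singleton] at h5
    obtain ⟨c, rfl⟩ := h5
    have h6 : HasDerivAt (fun s => (ζ s).2) ((c • Z (ζ s)).2) s := hw.snd
    have h7 : (fun s => (ζ s).2) =ᶠ[𝓝 s] fun _ => 0 := by
      filter_upwards [isOpen_Ioo.mem_nhds hs] with s' hs'
      have : γ s' ∈ F := by
        rw [← him]
        exact mem_image_of_mem γ (hsub1 s' hs')
      exact (hψ.mem_core_iff.1 this).2
    have h8 : c * (Z (ζ s)).2 = 0 :=
      h6.unique ((hasDerivAt_const s (0 : ℝ)).congr_of_eventuallyEq h7)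
    rw [(mul_eq_zero.1 h8).resolve_right h4, zero_smul] at hw
    exact hw
  obtain ⟨s₁, hs₁⟩ := exists_between hb
  obtain ⟨s₂, hs₂⟩ := exists_between hs₁.2
  have hm₂ : s₂ ∈ Ioo s₀ b := ⟨hs₁.1.trans hs₂.1, hs₂.2⟩
  have hconst : ζ s₂ = ζ s₁ := by
    have h1 := (convex_Ioo s₀ b).norm_image_sub_le_of_norm_hasDerivWithin_le (f := ζ)
      (f' := fun _ => 0) (C := 0) (fun s hs => (hder s hs).hasDerivWithinAt) (fun _ _ => by simp)
      hs₁ hm₂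
    rw [zero_mul] at h1
    exact sub_eq_zero.1 (norm_le_zero_iff.1 h1)
  have h1 := annularParam_annularLift θ (hball s₁ (hsub s₁ hs₁)).1.1
  have h2 := annularParam_annularLift θ (hball s₂ (hsub s₂ hm₂)).1.1
  have h3 : γ s₂ = γ s₁ := by
    rw [← h1, ← h2]
    exact congrArg _ hconst
  exact hs₂.1.ne' (hinj (hsub1 s₂ hm₂) (hsub1 s₁ hs₁) h3)

theorem mem_span_singleton_prod_iff {z w : ℝ × ℝ} (hz : z.1 ≠ 0) :
    w ∈ Submodule.span ℝ {z} ↔ w.2 = z.2 / z.1 * w.1 := by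
  rw [Submodule.mem_span_singleton]
  constructor
  · rintro ⟨c, rfl⟩
    simp only [Prod.smul_snd, Prod.smul_fst, smul_eq_mul]
    field_simp
  · intro h
    refine ⟨w.1 / z.1, Prod.ext ?_ ?_⟩
    · simp [hz]
    · simp only [Prod.smul_snd, smul_eq_mul]
      rw [h]
      ring

/-- Near the core the line field is the direction field of an equation `dr/dθ = f(θ, r)`; the
function `f` can be extended to the whole plane. -/
theorem exists_slope (L : LineFoliation I M) (hψ : ψ.target = univ ×ˢ Ioo (-ε) ε) (hε : 0 < ε)
    (hcore : ∀ θ : ℝ, ((1, 0) : ℝ × ℝ) ∈ planarLine L ψ (θ, 0)) :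
    ∃ ε₁ > 0, ε₁ ≤ ε ∧ ∃ f : ℝ × ℝ → ℝ, ContDiff ℝ ∞ f ∧
      (∀ r, Function.Periodic (fun θ => f (θ, r)) (2 * Real.pi)) ∧ (∀ θ, f (θ, 0) = 0) ∧
      ∀ x : ℝ × ℝ, x.2 ∈ Ioo (-ε₁) ε₁ → ∀ w : ℝ × ℝ, w ∈ planarLine L ψ x ↔ w.2 = f x * w.1 := by
  -- the line field is nowhere vertical in a whole strip around the core
  have htube : ∀ᶠ r in 𝓝 (0 : ℝ), ∀ θ : ℝ, r ∈ Ioo (-ε) ε ∧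
      ((0, 1) : ℝ × ℝ) ∉ planarLine L ψ (θ, r) := by
    refine eventually_forall_of_periodic (p := fun θ r => r ∈ Ioo (-ε) ε ∧
      ((0, 1) : ℝ × ℝ) ∉ planarLine L ψ (θ, r)) Real.two_pi_pos (fun θ r => ?_) fun θ => ?_
    · refine and_congr_right fun hr => ?_
      have h1 := planarLine_periodic L hψ (x := (θ, r)) hr
      rw [Prod.mk_add_mk, add_zero] at h1
      rw [h1]
    · have h0 : ((θ, 0) : ℝ × ℝ).2 ∈ Ioo (-ε) ε := ⟨neg_lt_zero.2 hε, hε⟩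
      obtain ⟨Z, O, hO, hθO, hZ, hZL⟩ := exists_local_generator L hψ h0
      have hZ1 : (Z (θ, 0)).1 ≠ 0 := by
        intro h1
        have h2 := hcore θ
        rw [(hZL _ hθO).2, Submodule.mem_span_singleton] at h2
        obtain ⟨c, hc⟩ := h2
        have h3 := congrArg Prod.fst hc
        simp [h1] at h3
      filter_upwards [(isOpen_strip ε).mem_nhds ⟨mem_univ _, h0⟩, hO.mem_nhds hθO,
        (hZ.continuousOn.continuousAt (hO.mem_nhds hθO)).fst.eventually_ne hZ1] with x hx hxO hxZ
      refine ⟨hx.2, ?_⟩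
      rw [(hZL x hxO).2, mem_span_singleton_prod_iff hxZ]
      simp
  obtain ⟨ε₂, hε₂, hball⟩ := Metric.eventually_nhds_iff_ball.1 htube
  rw [Real.ball_eq_Ioo, zero_sub, zero_add] at hball
  have hgen : ∀ x : ℝ × ℝ, x.2 ∈ Ioo (-ε₂) ε₂ → ∃ Z : ℝ × ℝ → ℝ × ℝ, ∃ O : Set (ℝ × ℝ),
      IsOpen O ∧ x ∈ O ∧ ContDiffOn ℝ ∞ Z O ∧ ∀ x' ∈ O, x'.2 ∈ Ioo (-ε₂) ε₂ →
        (Z x').1 ≠ 0 ∧ ∀ w, w ∈ planarLine L ψ x' ↔ w.2 = (Z x').2 / (Z x').1 * w.1 := by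
    intro x hx
    obtain ⟨Z, O, hO, hxO, hZ, hZL⟩ := exists_local_generator L hψ (hball x.2 hx x.1).1
    refine ⟨Z, O, hO, hxO, hZ, fun x' hx' hx'' => ?_⟩
    obtain ⟨hz0, hzl⟩ := hZL x' hx'
    have hz1 : (Z x').1 ≠ 0 := by
      intro h1
      apply (hball x'.2 hx'' x'.1).2
      have hz2 : (Z x').2 ≠ 0 := fun h => hz0 (Prod.ext h1 h)
      rw [hzl, Submodule.mem_span_singleton]
      refine ⟨(Z x').2⁻¹, Prod.ext ?_ ?_⟩
      · simp [h1]
      · simp [hz2]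
    refine ⟨hz1, fun w => ?_⟩
    rw [hzl, mem_span_singleton_prod_iff hz1]
  have hex : ∀ x : ℝ × ℝ, ∃ m : ℝ, x.2 ∈ Ioo (-ε₂) ε₂ →
      ∀ w, w ∈ planarLine L ψ x ↔ w.2 = m * w.1 := by
    intro x
    by_cases hx : x.2 ∈ Ioo (-ε₂) ε₂
    · obtain ⟨Z, O, -, hxO, -, hZ⟩ := hgen x hx
      exact ⟨_, fun _ => (hZ x hxO hx).2⟩
    · exact ⟨0, fun h => absurd h hx⟩
  choose m hm using hex
  have hmu : ∀ x : ℝ × ℝ, x.2 ∈ Ioo (-ε₂) ε₂ → ∀ n : ℝ, ((1, n) : ℝ × ℝ) ∈ planarLine L ψ x →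
      n = m x := by
    intro x hx n hn
    simpa using (hm x hx _).1 hn
  have hms : ∀ x : ℝ × ℝ, x.2 ∈ Ioo (-ε₂) ε₂ → ContDiffAt ℝ ∞ m x := by
    intro x hx
    obtain ⟨Z, O, hO, hxO, hZ, hZL⟩ := hgen x hx
    have hZx := hZ.contDiffAt (hO.mem_nhds hxO)
    refine (hZx.snd.div hZx.fst (hZL x hxO hx).1).congr_of_eventuallyEq ?_
    filter_upwards [hO.mem_nhds hxO, (isOpen_strip ε₂).mem_nhds ⟨mem_univ _, hx⟩] with x' hx' hx''
    refine (hmu x' hx''.2 _ ?_).symm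
    rw [(hZL x' hx' hx''.2).2]
    simp
  have hmper : ∀ θ r : ℝ, r ∈ Ioo (-ε₂) ε₂ → m (θ + 2 * Real.pi, r) = m (θ, r) := by
    intro θ r hr
    apply hmu (θ, r) hr
    have h1 := planarLine_periodic L hψ (x := (θ, r)) (hball r hr 0).1
    rw [Prod.mk_add_mk, add_zero] at h1
    rw [← h1, hm _ hr]
    simp
  -- a cutoff in the variable `r` extends the slope to the plane
  let χ : ContDiffBump (0 : ℝ) := ⟨ε₂ / 3, ε₂ / 2, by positivity, by linarith⟩
  have hχ0 : ∀ r, r ∉ Ioo (-ε₂) ε₂ → χ r = 0 := by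
    intro r hr
    refine χ.zero_of_le_dist ?_
    change ε₂ / 2 ≤ dist r 0
    rw [dist_zero_right, Real.norm_eq_abs]
    by_contra! hlt
    exact hr (abs_lt.1 (hlt.trans (by linarith)))
  refine ⟨ε₂ / 3, by positivity, ?_, fun x => χ x.2 * m x, ?_, fun r θ => ?_, fun θ => ?_, ?_⟩
  · by_contra! hlt
    have hmem : ε ∈ Ioo (-ε₂) ε₂ := ⟨by linarith, by linarith⟩
    exact lt_irrefl _ (hball ε hmem 0).1.2
  · rw [contDiff_iff_contDiffAt]
    intro x
    by_cases hx : x.2 ∈ Ioo (-ε₂) ε₂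
    · exact (χ.contDiff.comp contDiff_snd).contDiffAt.mul (hms x hx)
    · have hx' : x.2 ∉ Metric.closedBall (0 : ℝ) (ε₂ / 2) := by
        intro h
        rw [Real.closedBall_eq_Icc] at h
        exact hx ⟨by linarith [h.1], by linarith [h.2]⟩
      refine (contDiffAt_const (c := (0 : ℝ))).congr_of_eventuallyEq ?_
      have h1 : ∀ᶠ x' : ℝ × ℝ in 𝓝 x, x'.2 ∈ (Metric.closedBall (0 : ℝ) (ε₂ / 2))ᶜ :=
        continuous_snd.continuousAt.eventually_mem
          (Metric.isClosed_closedBall.isOpen_compl.mem_nhds hx')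
      filter_upwards [h1] with x' hx''
      rw [χ.zero_of_le_dist (by
        rw [mem_compl_iff, Metric.mem_closedBall, not_le] at hx''
        exact hx''.le), zero_mul]
  · dsimp only
    by_cases hr : r ∈ Ioo (-ε₂) ε₂
    · rw [hmper θ r hr]
    · rw [hχ0 r hr, zero_mul, zero_mul]
  · change χ 0 * m (θ, 0) = 0
    rw [← hmu (θ, 0) ⟨neg_lt_zero.2 hε₂, hε₂⟩ 0 (hcore θ), mul_zero]
  · intro x hx w
    have h1 : χ x.2 = 1 := by
      refine χ.one_of_mem_closedBall ?_
      change x.2 ∈ Metric.closedBall 0 (ε₂ / 3)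
      rw [Real.closedBall_eq_Icc]
      exact ⟨by linarith [hx.1], by linarith [hx.2]⟩
    change w ∈ planarLine L ψ x ↔ w.2 = χ x.2 * m x * w.1
    rw [h1, one_mul]
    exact hm x ⟨by linarith [hx.1], by linarith [hx.2]⟩ w

end Slope

/-! ### The monodromy and the mean of the linearized slope -/

section Monodromy

open Filter Topology

theorem fderiv_apply_of_eq_zero_on_axis {f : ℝ × ℝ → ℝ} (hf : ContDiff ℝ ∞ f)
    (h0 : ∀ θ, f (θ, 0) = 0) (θ : ℝ) (w : ℝ × ℝ) :
    fderiv ℝ f (θ, 0) w = fderiv ℝ f (θ, 0) (0, 1) * w.2 := by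
  have hd : HasFDerivAt f (fderiv ℝ f (θ, 0)) (θ, 0) :=
    (hf.differentiable (by simp)).differentiableAt.hasFDerivAt
  have h1 : HasDerivAt (fun θ : ℝ => f (θ, 0)) (fderiv ℝ f (θ, 0) (1, 0)) θ :=
    hd.comp_hasDerivAt θ ((hasDerivAt_id θ).prodMk (hasDerivAt_const θ (0 : ℝ)))
  have h2 : fderiv ℝ f (θ, 0) (1, 0) = 0 := by
    refine h1.unique ?_
    simp only [h0]
    exact hasDerivAt_const θ (0 : ℝ)
  have h3 : w = w.1 • ((1, 0) : ℝ × ℝ) + w.2 • ((0, 1) : ℝ × ℝ) := by ext <;> simp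
  conv_lhs => rw [h3]
  rw [map_add, map_smul, map_smul, h2]
  simp [mul_comm]

/-- The variational equation along `r = 0` of a family of integral curves `s ↦ W (s, t)` of
`dr/dθ = f(θ, r)`: the transverse component `κ` of the variation satisfies
`dκ/ds = ∂f/∂r · dθ/ds · κ`. -/
theorem hasDerivAt_variation {f : ℝ × ℝ → ℝ} (hf : ContDiff ℝ ∞ f) (h0 : ∀ θ, f (θ, 0) = 0)
    {W : ℝ × ℝ → ℝ × ℝ} {s : ℝ} (hW : ContDiffAt ℝ ∞ W (s, 0)) (hWs : (W (s, 0)).2 = 0)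
    (heq : ∀ᶠ x in 𝓝 (s, (0 : ℝ)),
      (fderiv ℝ W x (1, 0)).2 = f (W x) * (fderiv ℝ W x (1, 0)).1) :
    HasDerivAt (fun s' => (fderiv ℝ W (s', 0) (0, 1)).2)
      (fderiv ℝ f ((W (s, 0)).1, 0) (0, 1) * (fderiv ℝ W (s, 0) (0, 1)).2 *
        (fderiv ℝ W (s, 0) (1, 0)).1) s := by
  have hWp : W (s, 0) = ((W (s, 0)).1, 0) := Prod.ext rfl hWs
  have hD : HasFDerivAt (fderiv ℝ W) (fderiv ℝ (fderiv ℝ W) (s, 0)) (s, 0) :=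
    ((hW.fderiv_right (m := ∞) (by simp)).differentiableAt (by simp)).hasFDerivAt
  have hW' : HasFDerivAt W (fderiv ℝ W (s, 0)) (s, 0) :=
    (hW.differentiableAt (by simp)).hasFDerivAt
  have hsymm : fderiv ℝ (fderiv ℝ W) (s, 0) (1, 0) (0, 1) =
      fderiv ℝ (fderiv ℝ W) (s, 0) (0, 1) (1, 0) :=
    (hW.isSymmSndFDerivAt (by
      rw [minSmoothness_of_isRCLikeNormedField]
      exact WithTop.coe_le_coe.2 le_top)).eq _ _
  have hcol : ∀ v u : ℝ × ℝ, HasDerivAt (fun s' : ℝ => fderiv ℝ W ((s, 0) + s' • u) v)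
      (fderiv ℝ (fderiv ℝ W) (s, 0) u v) 0 := by
    intro v u
    have h1 : HasDerivAt (fun s' : ℝ => ((s, 0) : ℝ × ℝ) + s' • u) u 0 := by
      simpa using ((hasDerivAt_id (0 : ℝ)).smul_const u).const_add (s, 0)
    have h2 : HasFDerivAt (fderiv ℝ W) (fderiv ℝ (fderiv ℝ W) (s, 0))
        (((s, 0) : ℝ × ℝ) + (0 : ℝ) • u) := by simpa using hD
    exact ((ContinuousLinearMap.apply ℝ (ℝ × ℝ) v).hasFDerivAt.comp_hasDerivAt (0 : ℝ)
      (h2.comp_hasDerivAt (0 : ℝ) h1))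
  have hline : HasDerivAt (fun t : ℝ => ((s, 0) : ℝ × ℝ) + t • ((0, 1) : ℝ × ℝ)) (0, 1) 0 := by
    simpa using ((hasDerivAt_id (0 : ℝ)).smul_const ((0, 1) : ℝ × ℝ)).const_add (s, 0)
  have hlim : Tendsto (fun t : ℝ => ((s, 0) : ℝ × ℝ) + t • ((0, 1) : ℝ × ℝ)) (𝓝 0) (𝓝 (s, 0)) := by
    simpa using hline.continuousAt.tendsto
  have hfW : HasDerivAt (fun t : ℝ => f (W ((s, 0) + t • ((0, 1) : ℝ × ℝ))))
      (fderiv ℝ f ((W (s, 0)).1, 0) (0, 1) * (fderiv ℝ W (s, 0) (0, 1)).2) 0 := by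
    rw [← fderiv_apply_of_eq_zero_on_axis hf h0, ← hWp]
    have h1 : HasFDerivAt (f ∘ W) ((fderiv ℝ f (W (s, 0))).comp (fderiv ℝ W (s, 0)))
        (((s, 0) : ℝ × ℝ) + (0 : ℝ) • ((0, 1) : ℝ × ℝ)) := by
      rw [zero_smul, add_zero]
      exact (hf.differentiable (by simp)).differentiableAt.hasFDerivAt.comp _ hW'
    exact HasFDerivAt.comp_hasDerivAt (f := fun t : ℝ => ((s, 0) : ℝ × ℝ) + t • ((0, 1) : ℝ × ℝ))
      (0 : ℝ) h1 hline
  have hcol₁ : HasDerivAt (fun t : ℝ => (fderiv ℝ W ((s, 0) + t • ((0, 1) : ℝ × ℝ)) (1, 0)).1)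
      (fderiv ℝ (fderiv ℝ W) (s, 0) (0, 1) (1, 0)).1 0 := (hcol (1, 0) (0, 1)).fst
  have hl : HasDerivAt (fun t : ℝ => (fderiv ℝ W ((s, 0) + t • ((0, 1) : ℝ × ℝ)) (1, 0)).2)
      (fderiv ℝ (fderiv ℝ W) (s, 0) (0, 1) (1, 0)).2 0 := (hcol (1, 0) (0, 1)).snd
  have hr := hfW.mul hcol₁
  have hf0 : f (W (s, 0)) = 0 := by rw [hWp, h0]
  have hval := hl.unique (hr.congr_of_eventuallyEq (hlim.eventually heq))
  rw [zero_smul, add_zero, hf0, zero_mul, add_zero] at hval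
  have hs : HasDerivAt (fun s' => fderiv ℝ W (s', 0) (0, 1))
      (fderiv ℝ (fderiv ℝ W) (s, 0) (1, 0) (0, 1)) s :=
    (ContinuousLinearMap.apply ℝ (ℝ × ℝ) ((0, 1) : ℝ × ℝ)).hasFDerivAt.comp_hasDerivAt s
      (HasFDerivAt.comp_hasDerivAt (f := fun s' : ℝ => (s', (0 : ℝ))) s hD
        ((hasDerivAt_id s).prodMk (hasDerivAt_const s (0 : ℝ))))
  rw [hsymm] at hs
  have hs₂ : HasDerivAt (fun s' => (fderiv ℝ W (s', 0) (0, 1)).2)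
      (fderiv ℝ (fderiv ℝ W) (s, 0) (0, 1) (1, 0)).2 s := hs.snd
  exact hs₂.congr_deriv hval

variable {E H : Type*} [NormedAddCommGroup E] [NormedSpace ℝ E]
  [TopologicalSpace H] {I : ModelWithCorners ℝ E H}
  {M : Type*} [TopologicalSpace M] [ChartedSpace H M]
  {ψ : PartialDiffeomorph I ((𝓡 1).prod 𝓘(ℝ, ℝ)) M (Circle × ℝ) ∞} {ε : ℝ} {F : Set M}

theorem periodic_apply_annularLift_fst {A : ℝ → ℝ} (hA : Function.Periodic A (2 * Real.pi))
    (θ₀ θ₁ : ℝ) (y : M) : A (annularLift ψ θ₀ y).1 = A (annularLift ψ θ₁ y).1 := by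
  have h : annulusCover (annularLift ψ θ₀ y) = annulusCover (annularLift ψ θ₁ y) := by
    rw [annularLift, annularLift, annulusCover_annulusLift, annulusCover_annulusLift]
  obtain ⟨m, hm⟩ := annulusCover_eq_iff.1 h
  rw [hm]
  exact hA.int_mul m _

/-- The derivative at `t = 0` of the height over the core of the points `h (s, t)`. -/
noncomputable def transverseFactor
    (ψ : PartialDiffeomorph I ((𝓡 1).prod 𝓘(ℝ, ℝ)) M (Circle × ℝ) ∞) (h : ℝ × ℝ → M) (s : ℝ) : ℝ :=
  deriv (fun t => (ψ (h (s, t))).2) 0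

variable [IsManifold I ∞ M]

/-- If `A` is a primitive of the linearized slope, the transverse factor of a family of leaf paths
is a constant multiple of `exp A`. -/
theorem hasDerivAt_transverseFactor_mul_exp (L : LineFoliation I M) (hψ : IsAnnularChart F ε ψ)
    (hε : 0 < ε) {f : ℝ × ℝ → ℝ} (hf : ContDiff ℝ ∞ f) (h0 : ∀ θ, f (θ, 0) = 0)
    {ε₁ : ℝ} (hε₁ : 0 < ε₁)
    (hfL : ∀ x : ℝ × ℝ, x.2 ∈ Ioo (-ε₁) ε₁ → ∀ w : ℝ × ℝ, w ∈ planarLine L ψ x ↔ w.2 = f x * w.1)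
    {A : ℝ → ℝ} (hA : Function.Periodic A (2 * Real.pi))
    (hA' : ∀ θ, HasDerivAt A (fderiv ℝ f (θ, 0) (0, 1)) θ)
    {a : ℝ} (ha : 0 < a) {h : ℝ × ℝ → M}
    (hh : ContMDiffOn 𝓘(ℝ, ℝ × ℝ) I ∞ h (univ ×ˢ Ioo (-a) a))
    (hleaf : ∀ t ∈ Ioo (-a) a, L.IsLeafPath (fun s => h (s, t))) {s : ℝ} (hs : h (s, 0) ∈ F) :
    HasDerivAt (fun s => transverseFactor ψ h s *
      Real.exp (-A (annularLift ψ 0 (h (s, 0))).1)) 0 s := by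
  obtain ⟨hsrc, hs2⟩ := hψ.mem_core_iff.1 hs
  set θ₀ : ℝ := (annularLift ψ 0 (h (s, 0))).1 with hθ₀
  have hx : ((θ₀, 0) : ℝ × ℝ).2 ∈ Ioo (-ε) ε := ⟨neg_lt_zero.2 hε, hε⟩
  have hπ : |((θ₀, 0) : ℝ × ℝ).1 - θ₀| < Real.pi := by simp [Real.pi_pos]
  have hpar : annularParam ψ (θ₀, 0) = h (s, 0) := by
    rw [← annularParam_annularLift 0 hsrc]
    exact congrArg _ (Prod.ext rfl (by rw [annularLift_snd, hs2]))
  have hmem : ((s, 0) : ℝ × ℝ) ∈ (univ : Set ℝ) ×ˢ Ioo (-a) a :=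
    ⟨mem_univ _, neg_lt_zero.2 ha, ha⟩
  have hhs : ContMDiffAt 𝓘(ℝ, ℝ × ℝ) I ∞ h (s, 0) :=
    hh.contMDiffAt ((isOpen_strip a).mem_nhds hmem)
  set W : ℝ × ℝ → ℝ × ℝ := fun x => annularLift ψ θ₀ (h x) with hWdef
  have hW0 : W (s, 0) = (θ₀, 0) := by
    simp only [hWdef]
    rw [← hpar, annularLift_annularParam hψ.target_eq hx hπ]
  have hlift : ContMDiffAt I 𝓘(ℝ, ℝ × ℝ) ∞ (annularLift ψ θ₀) (h (s, 0)) := by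
    rw [← hpar]
    exact contMDiffAt_annularLift hψ.target_eq hx hπ
  have hW : ContDiffAt ℝ ∞ W (s, 0) := (hlift.comp (s, 0) hhs).contDiffAt
  have hWd : ∀ᶠ x in 𝓝 (s, (0 : ℝ)), DifferentiableAt ℝ W x := by
    filter_upwards [(hW.of_le (m := 1) (by simp)).eventually (by simp)] with x hx
    exact hx.differentiableAt (by simp)
  have hslope : ∀ᶠ x in 𝓝 (s, (0 : ℝ)),
      (fderiv ℝ W x (1, 0)).2 = f (W x) * (fderiv ℝ W x (1, 0)).1 := by
    have h1 : ∀ᶠ x in 𝓝 (s, (0 : ℝ)), h x ∈ annularArc ψ θ₀ :=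
      hhs.continuousAt.eventually_mem ((isOpen_annularArc θ₀).mem_nhds
        (by rw [← hpar]; exact annularParam_mem_annularArc hψ.target_eq hx hπ))
    have h2 : ∀ᶠ x in 𝓝 (s, (0 : ℝ)), |(W x).1 - θ₀| < Real.pi := by
      refine ContinuousAt.eventually_lt ?_ continuousAt_const (by rw [hW0]; exact hπ)
      exact (hW.continuousAt.fst.sub continuousAt_const).abs
    have h3 : ∀ᶠ x in 𝓝 (s, (0 : ℝ)), (W x).2 ∈ Ioo (-ε₁) ε₁ :=
      hW.continuousAt.snd.eventually_mem (isOpen_Ioo.mem_nhds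
        (by rw [hW0]; exact ⟨neg_lt_zero.2 hε₁, hε₁⟩))
    filter_upwards [h1, h2, h3, hWd, (isOpen_strip a).mem_nhds hmem] with x hx1 hx2 hx3 hx4 hx5
    have hl := hleaf x.2 hx5.2
    obtain ⟨w, hw, hwL⟩ := exists_hasDerivAt_annularLift_comp L hψ.target_eq
      (hl.smooth.mdifferentiable (by simp) x.1) hx1 hx2
    have h4 : HasDerivAt (fun s => W (s, x.2)) (fderiv ℝ W x (1, 0)) x.1 :=
      HasFDerivAt.comp_hasDerivAt (x := x.1) (f := fun s => (s, x.2)) hx4.hasFDerivAt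
        ((hasDerivAt_id x.1).prodMk (hasDerivAt_const x.1 x.2))
    rw [h4.unique hw]
    exact (hfL (W x) hx3 w).1 (hwL.2 (hl.tangent x.1))
  have hvar := hasDerivAt_variation hf h0 hW (by rw [hW0]) hslope
  have hWs' : HasDerivAt (fun s' => W (s', 0)) (fderiv ℝ W (s, 0) (1, 0)) s :=
    HasFDerivAt.comp_hasDerivAt (f := fun s' : ℝ => (s', (0 : ℝ))) s
      (hW.differentiableAt (by simp)).hasFDerivAt
      ((hasDerivAt_id s).prodMk (hasDerivAt_const s (0 : ℝ)))
  have hWs : HasDerivAt (fun s' => (W (s', 0)).1) (fderiv ℝ W (s, 0) (1, 0)).1 s := hWs'.fst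
  have hexp := ((hA' (W (s, 0)).1).comp s hWs).neg.exp
  have hJ := hvar.mul hexp
  have hax : Tendsto (fun s' : ℝ => (s', (0 : ℝ))) (𝓝 s) (𝓝 (s, 0)) :=
    (by fun_prop : Continuous fun s' : ℝ => (s', (0 : ℝ))).continuousAt
  refine (hJ.congr_of_eventuallyEq ?_).congr_deriv ?_
  · filter_upwards [hax.eventually hWd] with s' hs'
    have h4 : HasDerivAt (fun t => W (s', t)) (fderiv ℝ W (s', 0) (0, 1)) 0 :=
      HasFDerivAt.comp_hasDerivAt (f := fun t : ℝ => (s', t)) (0 : ℝ) hs'.hasFDerivAt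
        ((hasDerivAt_const (0 : ℝ) s').prodMk (hasDerivAt_id (0 : ℝ)))
    have h5 : HasDerivAt (fun t => (W (s', t)).2) (fderiv ℝ W (s', 0) (0, 1)).2 0 := h4.snd
    have h6 : transverseFactor ψ h s' = (fderiv ℝ W (s', 0) (0, 1)).2 := h5.deriv
    rw [h6, periodic_apply_annularLift_fst hA 0 θ₀]
    rfl
  · simp only [Pi.neg_apply, Function.comp_apply]
    ring

/-- If the linear monodromy `c` is not `1`, the linearized slope has nonzero mean. Were the mean
zero, the linearized slope would have a periodic primitive, so the transverse factor would take the
same value at both ends of the closed leaf; but the values are `κ` and `κ c` with `κ ≠ 0`. -/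
theorem integral_fderiv_slope_ne_zero (L : LineFoliation I M) (hψ : IsAnnularChart F ε ψ)
    (hε : 0 < ε) {f : ℝ × ℝ → ℝ} (hf : ContDiff ℝ ∞ f) (h0 : ∀ θ, f (θ, 0) = 0)
    (hper : ∀ r, Function.Periodic (fun θ => f (θ, r)) (2 * Real.pi))
    {ε₁ : ℝ} (hε₁ : 0 < ε₁)
    (hfL : ∀ x : ℝ × ℝ, x.2 ∈ Ioo (-ε₁) ε₁ → ∀ w : ℝ × ℝ, w ∈ planarLine L ψ x ↔ w.2 = f x * w.1)
    {τ : ℝ → M} {P : ℝ → ℝ} (hP : L.IsReturnMap F τ P) {c : ℝ} (hc : HasDerivAt P c 0)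
    (hc1 : c ≠ 1) :
    ∫ θ in (0 : ℝ)..2 * Real.pi, fderiv ℝ f (θ, 0) (0, 1) ≠ 0 := by
  obtain ⟨hτ, hP0, a, ha, h, hh, hleaf, -, him, hend⟩ := hP
  intro hmean
  have h00 : (0 : ℝ) ∈ Ioo (-a) a := ⟨neg_lt_zero.2 ha, ha⟩
  have hfirst : h (0, 0) = τ 0 := (hend 0 h00).1
  have hlast : h (1, 0) = τ 0 := by rw [(hend 0 h00).2, hP0]
  have hτF : τ 0 ∈ F := by
    rw [← him, ← hfirst]
    exact mem_image_of_mem (fun s => h (s, 0)) (left_mem_Ico.2 one_pos)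
  have hF : ∀ s ∈ Icc (0 : ℝ) 1, h (s, 0) ∈ F := by
    intro s hs
    rcases hs.2.eq_or_lt with rfl | hlt
    · rwa [hlast]
    · rw [← him]
      exact mem_image_of_mem (fun s => h (s, 0)) ⟨hs.1, hlt⟩
  have hacont : ContDiff ℝ ∞ fun θ : ℝ => fderiv ℝ f (θ, 0) (0, 1) :=
    ((hf.fderiv_right (m := ∞) (by simp)).comp
      (contDiff_id.prodMk contDiff_const)).clm_apply contDiff_const
  have haper : Function.Periodic (fun θ : ℝ => fderiv ℝ f (θ, 0) (0, 1)) (2 * Real.pi) := by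
    intro θ
    have h1 : (fun x : ℝ × ℝ => f (x + (2 * Real.pi, 0))) = f := by
      funext x
      have := hper x.2 x.1
      simpa [Prod.add_def] using this
    have h2 : fderiv ℝ (fun x : ℝ × ℝ => f (x + (2 * Real.pi, 0))) (θ, 0) =
        fderiv ℝ f ((θ, 0) + (2 * Real.pi, 0)) := fderiv_comp_add_right _
    rw [h1, Prod.mk_add_mk, add_zero] at h2
    exact congrArg (fun l : ℝ × ℝ →L[ℝ] ℝ => l (0, 1)) h2.symm
  obtain ⟨A, -, hAper, hA⟩ := exists_periodic_primitive hacont Real.two_pi_pos haper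
  simp only [hmean, zero_div, sub_zero] at hA
  set J : ℝ → ℝ := fun s => transverseFactor ψ h s *
    Real.exp (-A (annularLift ψ 0 (h (s, 0))).1) with hJdef
  have hJ : ∀ s ∈ Icc (0 : ℝ) 1, HasDerivAt J 0 s := fun s hs =>
    hasDerivAt_transverseFactor_mul_exp L hψ hε hf h0 hε₁ hfL hAper hA ha hh hleaf (hF s hs)
  have hJ01 : J 1 = J 0 := by
    have h1 := (convex_Icc (0 : ℝ) 1).norm_image_sub_le_of_norm_hasDerivWithin_le (f := J)
      (f' := fun _ => 0) (C := 0) (fun s hs => (hJ s hs).hasDerivWithinAt) (fun _ _ => by simp)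
      (left_mem_Icc.2 zero_le_one) (right_mem_Icc.2 zero_le_one)
    rw [zero_mul] at h1
    exact sub_eq_zero.1 (norm_le_zero_iff.1 h1)
  have hκ : transverseFactor ψ h 1 = transverseFactor ψ h 0 := by
    simp only [hJdef, hfirst, hlast] at hJ01
    exact mul_right_cancel₀ (Real.exp_pos _).ne' hJ01
  -- the derivative of the height along the transversal
  obtain ⟨hsrc, hτ2⟩ := hψ.mem_core_iff.1 hτF
  set θ₀ : ℝ := (annularLift ψ 0 (τ 0)).1 with hθ₀
  have hx : ((θ₀, 0) : ℝ × ℝ).2 ∈ Ioo (-ε) ε := ⟨neg_lt_zero.2 hε, hε⟩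
  have hπ : |((θ₀, 0) : ℝ × ℝ).1 - θ₀| < Real.pi := by simp [Real.pi_pos]
  have hpar : annularParam ψ (θ₀, 0) = τ 0 := by
    rw [← annularParam_annularLift 0 hsrc]
    exact congrArg _ (Prod.ext rfl (by rw [annularLift_snd, hτ2]))
  have hlift : annularLift ψ θ₀ (τ 0) = (θ₀, 0) := by
    rw [← hpar, annularLift_annularParam hψ.target_eq hx hπ]
  obtain ⟨w, hw, hwL⟩ := exists_hasDerivAt_annularLift_comp L hψ.target_eq (θ₀ := θ₀)
    (hτ.smooth.mdifferentiable (by simp) 0)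
    (by rw [← hpar]; exact annularParam_mem_annularArc hψ.target_eq hx hπ)
    (by rw [hlift]; exact hπ)
  have hw2 : w.2 ≠ 0 := by
    intro h1
    apply hτ.transverse 0
    rw [← hwL, hlift, hfL _ ⟨neg_lt_zero.2 hε₁, hε₁⟩, h0, zero_mul, h1]
  have hheight : HasDerivAt (fun t => (ψ (τ t)).2) w.2 0 := hw.snd
  have hIoo : Ioo (-a) a ∈ 𝓝 (0 : ℝ) := isOpen_Ioo.mem_nhds h00
  have hκ0 : transverseFactor ψ h 0 = w.2 := by
    refine (hheight.congr_of_eventuallyEq ?_).deriv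
    filter_upwards [hIoo] with t ht
    rw [(hend t ht).1]
  have hκ1 : transverseFactor ψ h 1 = w.2 * c := by
    have h1 : HasDerivAt (fun t => (ψ (τ (P t))).2) (w.2 * c) 0 :=
      HasDerivAt.comp_of_eq (0 : ℝ) hheight hc hP0.symm
    refine (h1.congr_of_eventuallyEq ?_).deriv
    filter_upwards [hIoo] with t ht
    rw [(hend t ht).2]
  rw [hκ0, hκ1] at hκ
  exact hc1 (mul_left_cancel₀ hw2 (hκ.trans (mul_one _).symm))

end Monodromy

/-! ### The linear form in planar coordinates -/

section LinearForm

open Filter Topology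

theorem angularForm_mfderiv_exp (θ t : ℝ) :
    angularForm (Circle.exp θ) (mfderiv 𝓘(ℝ, ℝ) (𝓡 1) Circle.exp θ t) = t := by
  have h1 := mfderiv_comp_apply θ
    ((contMDiff_circle_coe (Circle.exp θ)).mdifferentiableAt (by simp))
    ((contMDiff_circleExp (m := ∞) θ).mdifferentiableAt (by simp)) t
  have h2 : HasDerivAt (fun θ : ℝ => Complex.exp (θ * Complex.I))
      (Complex.exp (θ * Complex.I) * (1 * Complex.I)) θ :=
    ((Complex.ofRealCLM.hasDerivAt (x := θ)).mul_const Complex.I).cexp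
  have h3 : (fun z : Circle => (z : ℂ)) ∘ Circle.exp =
      fun θ : ℝ => Complex.exp (θ * Complex.I) := by
    funext θ
    simp [Circle.coe_exp]
  rw [h3, mfderiv_eq_fderiv, h2.hasFDerivAt.fderiv] at h1
  have h4 : (starRingEnd ℂ) (Circle.exp θ : ℂ) * (Circle.exp θ : ℂ) = 1 := by
    rw [← Complex.normSq_eq_conj_mul_self, Circle.normSq_coe, Complex.ofReal_one]
  change ((starRingEnd ℂ) (Circle.exp θ : ℂ) * _).im = t
  refine (congrArg (fun z : ℂ => ((starRingEnd ℂ) (Circle.exp θ : ℂ) * z).im) h1.symm).trans ?_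
  change ((starRingEnd ℂ) (Circle.exp θ : ℂ) *
    (t • (Complex.exp (θ * Complex.I) * (1 * Complex.I)))).im = t
  rw [← Circle.coe_exp, mul_smul_comm, ← mul_assoc, h4]
  simp

/-- The form `linearForm k`, read in the model space. -/
noncomputable def modelLinearForm (k : ℝ) (p : Circle × ℝ) :
    EuclideanSpace ℝ (Fin 1) × ℝ →ₗ[ℝ] ℝ := linearForm k p

/-- The derivative of `annulusCover`, read in the model spaces. -/
noncomputable def coverDeriv (x : ℝ × ℝ) : ℝ × ℝ →L[ℝ] EuclideanSpace ℝ (Fin 1) × ℝ :=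
  mfderiv 𝓘(ℝ, ℝ × ℝ) ((𝓡 1).prod 𝓘(ℝ, ℝ)) annulusCover x

theorem modelLinearForm_coverDeriv (k : ℝ) (x w : ℝ × ℝ) :
    modelLinearForm k (annulusCover x) (coverDeriv x w) = w.2 + k * x.2 * w.1 := by
  have h1 : HasMFDerivAt 𝓘(ℝ, ℝ × ℝ) 𝓘(ℝ, ℝ) (fun x : ℝ × ℝ => x.1) x
      (ContinuousLinearMap.fst ℝ ℝ ℝ) := hasFDerivAt_fst.hasMFDerivAt
  have h2 : HasMFDerivAt 𝓘(ℝ, ℝ × ℝ) 𝓘(ℝ, ℝ) (fun x : ℝ × ℝ => x.2) x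
      (ContinuousLinearMap.snd ℝ ℝ ℝ) := hasFDerivAt_snd.hasMFDerivAt
  have h3 := ((contMDiff_circleExp (m := ∞) x.1).mdifferentiableAt (by simp)).hasMFDerivAt
  have h4 := (h3.comp x h1).prodMk h2
  have h5 : coverDeriv x = _ := h4.mfderiv
  rw [h5]
  change w.2 + (k * x.2) * angularForm (Circle.exp x.1)
    (mfderiv 𝓘(ℝ, ℝ) (𝓡 1) Circle.exp x.1 w.1) = _
  rw [angularForm_mfderiv_exp]

end LinearForm

/-! ### The linearizing chart -/

section Chart

open Filter Topology

variable {E H : Type*} [NormedAddCommGroup E] [NormedSpace ℝ E]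
  [TopologicalSpace H] {I : ModelWithCorners ℝ E H}
  {M : Type*} [TopologicalSpace M] [ChartedSpace H M]
  {ψ : PartialDiffeomorph I ((𝓡 1).prod 𝓘(ℝ, ℝ)) M (Circle × ℝ) ∞} {ε : ℝ}

/-- The derivative of a map to the annulus, read in the model spaces. -/
noncomputable def chartDeriv (I : ModelWithCorners ℝ E H) (φ : M → Circle × ℝ) (y : M) :
    E →L[ℝ] EuclideanSpace ℝ (Fin 1) × ℝ :=
  mfderiv I ((𝓡 1).prod 𝓘(ℝ, ℝ)) φ y

theorem chartDeriv_paramDeriv (hψ : ψ.target = univ ×ˢ Ioo (-ε) ε) {φ : M → Circle × ℝ}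
    {G : ℝ × ℝ → ℝ × ℝ} {G' : ℝ × ℝ →L[ℝ] ℝ × ℝ} {x : ℝ × ℝ} (hG : HasFDerivAt G G' x)
    (hx : (G x).2 ∈ Ioo (-ε) ε)
    (hφ : MDifferentiableAt I ((𝓡 1).prod 𝓘(ℝ, ℝ)) φ (annularParam ψ (G x)))
    (hφG : ∀ᶠ x' in 𝓝 x, φ (annularParam ψ (G x')) = annulusCover x') (w : ℝ × ℝ) :
    chartDeriv I φ (annularParam ψ (G x)) (paramDeriv ψ (G x) (G' w)) = coverDeriv x w := by
  have h1 := (mdifferentiableAt_annularParam hψ hx).hasMFDerivAt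
  have h2 := hφ.hasMFDerivAt.comp x (h1.comp x hG.hasMFDerivAt)
  have h3 : φ ∘ annularParam ψ ∘ G =ᶠ[𝓝 x] annulusCover := hφG
  have h4 : coverDeriv x = _ := (h2.congr_of_eventuallyEq h3.symm).mfderiv
  rw [h4]
  rfl

variable [IsManifold I ∞ M]

/-- If `G (θ, ρ) = (θ, B (θ, ρ))` maps the solutions of `dρ/dθ = μ ρ` to those of
`dr/dθ = f(θ, r)`, a chart in which the parametrization `annularParam ψ ∘ G` becomes `annulusCover`
maps the line field to the kernel of `dr - μ r dθ`. -/
theorem mem_direction_iff_modelLinearForm (L : LineFoliation I M)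
    (hψ : ψ.target = univ ×ˢ Ioo (-ε) ε) {f : ℝ × ℝ → ℝ} {B : ℝ × ℝ → ℝ} {μ : ℝ} {x : ℝ × ℝ}
    (hx : B x ∈ Ioo (-ε) ε)
    (hf : ∀ w : ℝ × ℝ, w ∈ planarLine L ψ (x.1, B x) ↔ w.2 = f (x.1, B x) * w.1)
    (hB : DifferentiableAt ℝ B x) (hpos : 0 < fderiv ℝ B x (0, 1))
    (hBf : fderiv ℝ B x (1, μ * x.2) = f (x.1, B x)) {φ : M → Circle × ℝ}
    (hφ : MDifferentiableAt I ((𝓡 1).prod 𝓘(ℝ, ℝ)) φ (annularParam ψ (x.1, B x)))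
    (hφB : ∀ᶠ x' : ℝ × ℝ in 𝓝 x, φ (annularParam ψ (x'.1, B x')) = annulusCover x') (v : E) :
    v ∈ L.direction (annularParam ψ (x.1, B x)) ↔ modelLinearForm (-μ) (annulusCover x)
      (chartDeriv I φ (annularParam ψ (x.1, B x)) v) = 0 := by
  have hG : HasFDerivAt (fun x : ℝ × ℝ => (x.1, B x))
      ((ContinuousLinearMap.fst ℝ ℝ ℝ).prod (fderiv ℝ B x)) x :=
    hasFDerivAt_fst.prodMk hB.hasFDerivAt
  have hlin : ∀ w : ℝ × ℝ, fderiv ℝ B x w =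
      f (x.1, B x) * w.1 + fderiv ℝ B x (0, 1) * (w.2 - μ * x.2 * w.1) := by
    intro w
    have h1 : w = w.1 • ((1, μ * x.2) : ℝ × ℝ) + (w.2 - μ * x.2 * w.1) • ((0, 1) : ℝ × ℝ) := by
      ext
      · simp
      · simp
        ring
    conv_lhs => rw [h1, map_add, map_smul, map_smul, hBf]
    simp only [smul_eq_mul]
    ring
  have hπ : |((x.1, B x) : ℝ × ℝ).1 - x.1| < Real.pi := by simp [Real.pi_pos]
  -- the derivative of `G` is triangular with nonzero diagonal
  obtain ⟨w, rfl⟩ : ∃ w : ℝ × ℝ,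
      v = paramDeriv ψ (x.1, B x) (((ContinuousLinearMap.fst ℝ ℝ ℝ).prod (fderiv ℝ B x)) w) := by
    set u := liftDeriv ψ x.1 (annularParam ψ (x.1, B x)) v with hu
    have hv : paramDeriv ψ (x.1, B x) u = v := paramDeriv_liftDeriv hψ hx hπ v
    refine ⟨(u.1, μ * x.2 * u.1 + (u.2 - f (x.1, B x) * u.1) / fderiv ℝ B x (0, 1)), ?_⟩
    rw [← hv]
    congr 1
    refine Prod.ext rfl ?_
    change u.2 = fderiv ℝ B x _
    rw [hlin]
    field_simp
    ring
  rw [← mem_planarLine_iff, hf,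
    chartDeriv_paramDeriv (G := fun x : ℝ × ℝ => (x.1, B x)) hψ hG hx hφ hφB w,
    modelLinearForm_coverDeriv]
  change fderiv ℝ B x w = f (x.1, B x) * w.1 ↔ _
  rw [hlin, add_eq_left, mul_eq_zero, or_iff_right hpos.ne']
  constructor <;> intro h <;> linarith

end Chart

theorem mainTheorem10
    {E H : Type*} [NormedAddCommGroup E] [NormedSpace ℝ E] [TopologicalSpace H]
    (hE : Module.finrank ℝ E = 2) (I : ModelWithCorners ℝ E H)
    {M : Type*} [TopologicalSpace M] [T2Space M] [SecondCountableTopology M]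
    [ChartedSpace H M] [IsManifold I ∞ M] [BoundarylessManifold I M]
    (L : LineFoliation I M) (F : Set M) (hF : L.IsNondegenerateClosedLeaf F)
    (ε : ℝ) (hε : 0 < ε)
    (ψ : PartialDiffeomorph I ((𝓡 1).prod 𝓘(ℝ, ℝ)) M (Circle × ℝ) ∞)
    (hψ : IsAnnularChart F ε ψ) :
    ∃ δ : ℝ, 0 < δ ∧
      ∃ φ : PartialDiffeomorph I ((𝓡 1).prod 𝓘(ℝ, ℝ)) M (Circle × ℝ) ∞,
        F ⊆ φ.source ∧ φ.source ⊆ ψ.source ∧ IsAnnularChart F δ φ ∧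
        ∃ k : ℝ, k ≠ 0 ∧ ∀ y ∈ φ.source,
          L.line y = (LinearMap.ker (linearForm k (φ y))).comap
            (mfderiv I ((𝓡 1).prod 𝓘(ℝ, ℝ)) φ y).toLinearMap := by
  obtain ⟨-, c, -, hc1, τ, P, hP, hc⟩ := hF
  have hcore : ∀ θ : ℝ, ((1, 0) : ℝ × ℝ) ∈ planarLine L ψ (θ, 0) := by
    obtain ⟨-, -, a, ha, h, -, hleaf, hinj, him, -⟩ := hP
    exact horizontal_mem_planarLine L hψ hε (hleaf 0 ⟨neg_lt_zero.2 ha, ha⟩) hinj him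
  obtain ⟨ε₁, hε₁, hle, f, hf, hper, h0, hfL⟩ := exists_slope L hψ.target_eq hε hcore
  have hmean := integral_fderiv_slope_ne_zero L hψ hε hf h0 hper hε₁ hfL hP hc hc1
  obtain ⟨μ, hμ, δ, hδ, B, hB, hB0, hBall⟩ :=
    exists_linearizing_substitution hf h0 Real.two_pi_pos hper hmean hε₁
  obtain ⟨Λ, hΛt, hΛ⟩ := exists_partialDiffeomorph_of_substitution hB
    (fun θ ρ hρ => (hBall θ ρ hρ).1) (fun θ ρ hρ => (hBall θ ρ hρ).2.2.1)
  have hBε : ∀ x : ℝ × ℝ, x.2 ∈ Ioo (-δ) δ → B x ∈ Ioo (-ε) ε := fun x hx =>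
    have h := (hBall x.1 x.2 hx).2.1
    ⟨by linarith [h.1], by linarith [h.2]⟩
  -- In the cover, `Λ` is the inverse of `(θ, ρ) ↦ (θ, B (θ, ρ))`; the chart is `Λ ∘ ψ`.
  have hcov : ∀ p : Circle × ℝ, ∃ x, annulusCover x = p := fun p =>
    ⟨annulusLift 0 p, annulusCover_annulusLift 0 p⟩
  have hΛx : ∀ x : ℝ × ℝ, x.2 ∈ Ioo (-δ) δ → annulusCover x ∈ Λ.target := by
    intro x hx
    rw [hΛt]
    exact ⟨mem_univ _, hx⟩
  have hΛB : ∀ x : ℝ × ℝ, x.2 ∈ Ioo (-δ) δ → Λ (annulusCover (x.1, B x)) = annulusCover x := by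
    intro x hx
    rw [← hΛ x.1 x.2 hx]
    exact Λ.right_inv (hΛx x hx)
  have hsrc : ∀ x : ℝ × ℝ, x.2 ∈ Ioo (-δ) δ → annulusCover (x.1, B x) ∈ Λ.source := by
    intro x hx
    rw [← hΛ x.1 x.2 hx]
    exact Λ.map_target (hΛx x hx)
  have hparam : ∀ p ∈ Λ.source, ∃ x : ℝ × ℝ, x.2 ∈ Ioo (-δ) δ ∧ annulusCover (x.1, B x) = p := by
    intro p hp
    obtain ⟨x, hx⟩ := hcov (Λ p)
    have hx2 : annulusCover x ∈ Λ.target := by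
      rw [hx]
      exact Λ.map_source hp
    rw [hΛt] at hx2
    refine ⟨x, hx2.2, ?_⟩
    rw [← hΛ x.1 x.2 hx2.2]
    change Λ.symm (annulusCover x) = p
    rw [hx]
    exact Λ.left_inv hp
  set φ := ψ.trans Λ with hφdef
  have hφs : φ.source = ψ.source ∩ ψ ⁻¹' Λ.source := rfl
  have hφt : φ.target = Λ.target ∩ Λ.symm ⁻¹' ψ.target := rfl
  have hφa : ∀ y, φ y = Λ (ψ y) := fun _ => rfl
  have hφparam : ∀ x : ℝ × ℝ, x.2 ∈ Ioo (-δ) δ →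
      φ (annularParam ψ (x.1, B x)) = annulusCover x := by
    intro x hx
    rw [hφa, apply_annularParam hψ.target_eq (hBε x hx), hΛB x hx]
  have hφx : ∀ y ∈ φ.source, ∃ x : ℝ × ℝ, x.2 ∈ Ioo (-δ) δ ∧ annularParam ψ (x.1, B x) = y := by
    rintro y ⟨hy, hy'⟩
    obtain ⟨x, hx, hxy⟩ := hparam _ hy'
    refine ⟨x, hx, ?_⟩
    rw [annularParam, hxy]
    exact ψ.left_inv hy
  have hxφ : ∀ x : ℝ × ℝ, x.2 ∈ Ioo (-δ) δ → annularParam ψ (x.1, B x) ∈ φ.source := by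
    intro x hx
    refine ⟨annularParam_mem_source hψ.target_eq (hBε x hx), ?_⟩
    change ψ (annularParam ψ (x.1, B x)) ∈ Λ.source
    rw [apply_annularParam hψ.target_eq (hBε x hx)]
    exact hsrc x hx
  have hδ0 : (0 : ℝ) ∈ Ioo (-δ) δ := ⟨neg_lt_zero.2 hδ, hδ⟩
  have hFparam : ∀ y ∈ F, ∃ θ : ℝ, annularParam ψ (θ, 0) = y := by
    intro y hy
    obtain ⟨hys, hy2⟩ := hψ.mem_core_iff.1 hy
    obtain ⟨x, hx⟩ := hcov (ψ y)
    have hx2 : x.2 = 0 := by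
      rw [← hx] at hy2
      exact hy2
    refine ⟨x.1, ?_⟩
    have hx' : ((x.1, 0) : ℝ × ℝ) = x := Prod.ext rfl hx2.symm
    rw [hx', annularParam, hx]
    exact ψ.left_inv hys
  have hFφ : F ⊆ φ.source := by
    intro y hy
    obtain ⟨θ, rfl⟩ := hFparam y hy
    have h := hxφ (θ, 0) hδ0
    rwa [hB0] at h
  refine ⟨δ, hδ, φ, hFφ, inter_subset_left, ⟨?_, ?_⟩, -μ, neg_ne_zero.2 hμ, ?_⟩
  · rw [hφt, hΛt]
    refine inter_eq_left.2 fun p hp => ?_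
    obtain ⟨x, rfl⟩ := hcov p
    change Λ.symm (annulusCover (x.1, x.2)) ∈ ψ.target
    rw [hΛ x.1 x.2 hp.2]
    exact annulusCover_mem_target hψ.target_eq (hBε x hp.2)
  · ext y
    constructor
    · rintro ⟨hys, -, hy2⟩
      obtain ⟨x, hx, rfl⟩ := hφx y hys
      have hy2' : (φ (annularParam ψ (x.1, B x))).2 = 0 := hy2
      rw [hφparam x hx] at hy2'
      have hx' : x = (x.1, 0) := Prod.ext rfl hy2'
      rw [hx', hB0]
      exact hψ.annularParam_mem_core hε x.1
    · intro hy
      refine ⟨hFφ hy, mem_univ _, ?_⟩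
      obtain ⟨θ, rfl⟩ := hFparam y hy
      have h := hφparam (θ, 0) hδ0
      rw [hB0] at h
      change (φ (annularParam ψ (θ, 0))).2 = 0
      rw [h]
      rfl
  · intro y hy
    obtain ⟨x, hx, rfl⟩ := hφx y hy
    have hxs : x ∈ (univ : Set ℝ) ×ˢ Ioo (-δ) δ := ⟨mem_univ _, hx⟩
    have hnhds := (isOpen_strip δ).mem_nhds hxs
    obtain ⟨-, hBx, hpos, hBf⟩ := hBall x.1 x.2 hx
    have key := mem_direction_iff_modelLinearForm L hψ.target_eq (μ := μ) (hBε x hx)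
      (hfL (x.1, B x) hBx) ((hB.contDiffAt hnhds).differentiableAt (by simp)) hpos hBf
      (φ := φ) (φ.mdifferentiableAt (by simp) hy)
      (by filter_upwards [hnhds] with x' hx' using hφparam x' hx'.2)
    rw [← hφparam x hx] at key
    exact SetLike.ext key
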